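/- Let $d\in\{2,3\}$ and let $D\subset\mathbb R^d$ be a bounded Lipschitz domain. Let $E_1,\dots,E_K\subset\partial D$ be pairwise disjoint, nonempty, connected, relatively open subsets of $\partial D$ (electrodes), and let $\zeta\in L^\infty(\partial D)$ satisfy $\zeta\ge 0$, $\zeta=0$ almost everywhere on $\partial D\setminus\bigcup_kE_k$, and $\zeta|_{E_k}\not\equiv 0$ for all $k$. For $y\in U:=[-1,1]^{\mathbb N}$ let $\sigma(x,y)=\bar\sigma(x)+\sum_{j\ge1}y_j\psi_j(x)$ with $\bar\sigma,\psi_j\in L^\infty(D)$, and assume that there are constants $\sigma^\pm$ with $0<\sigma^-\le\sigma(x,y)\le\sigma^+<\infty$ (the series converging) for almost all $x\in D$ and all $y\in U$. For $I\in\mathbb R^K_\diamond:=\{I\in\mathbb R^K: I_1+\dots+I_K=0\}$ let $V(\sigma;I)\in\mathbb R^K_\diamond$ be the electrode voltage vector, i.e. the vector for which there is $v\in H^1(D)$ such that $$\int_D\sigma\nabla v\cdot\nabla w\,dx+\int_{\partial D}\zeta\,(V-v)(W-w)\,dS=I\cdot W\qquad\text{for all }(w,W)\in H^1(D)\times\mathbb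 R^K,$$ where in the boundary integral $v,w$ denote traces and vectors $V,W$ denote the functions $\sum_kV_k1_{E_k}$, $\sum_kW_k1_{E_k}$. Fix linearly independent $I^{(1)},\dots,I^{(K-1)}\in\mathbb R^K_\diamond$ and put $\mathcal G(y)=\big(V(\sigma(\cdot,y);I^{(1)}),\dots,V(\sigma(\cdot,y);I^{(K-1)})\big)\in\mathbb R^{K(K-1)}$. Let $\Sigma$ be a symmetric positive definite matrix of size $K(K-1)$, let $y$ be a random element of $U$ with law $\mu_0=\bigotimes_{j\ge1}\frac{dy_j}{2}$ (the prior), let $\vartheta\sim N(0,\Sigma)$ be independent of $y$, and let the data be $\delta=\mathcal G(y)+\vartheta$. Put $\Phi(y;\delta)=\frac12|\Sigma^{-1/2}(\delta-\mathcal G(y))|^2$. Then $V(\sigma(\cdot,y);I)$ exists and is unique for all $y\in U$ and $I\in\mathbb R^K_\diamond$, the map $\mathcal G:U\to\mathbb R^{K(K-1)}$ is measurable, and the posterior $\mu^\delta=\mathbb P(y\mid\delta)$ exists: the regular conditional distribution of $y$ given the data (unique up to null sets of the law of the data) has a version $(\mu^\delta)_\delta$, a Markov kernel, such that for every $\delta\in\mathbb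 R^{K(K-1)}$ the measure $\mu^\delta$ is absolutely continuous with respect to $\mu_0$ and $$\frac{d\mu^\delta}{d\mu_0}(y)\propto\exp(-\Phi(y;\delta)).$$ -/

import Mathlib

open MeasureTheory ProbabilityTheory Filter Topology
open scoped ENNReal NNReal

noncomputable section

namespace EIT

/-! ### Lipschitz domains and the surface measure -/

/-- A bounded Lipschitz domain in `ℝ^d`: a bounded, connected, nonempty open set which, near every
boundary point and after a rotation `T` of the coordinates, is the part of the space lying strictly
above the graph of a Lipschitz function `γ` (in the direction of the `i`-th coordinate). -/
structure IsLipschitzDomain {d : ℕ} (D : Set (EuclideanSpace ℝ (Fin d))) : Prop where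
  isOpen : IsOpen D
  isConnected : IsConnected D
  isBounded : Bornology.IsBounded D
  locally_graph : ∀ x ∈ frontier D,
    ∃ (T : EuclideanSpace ℝ (Fin d) ≃ₗᵢ[ℝ] EuclideanSpace ℝ (Fin d)) (i : Fin d)
      (γ : ({j : Fin d // j ≠ i} → ℝ) → ℝ) (L : ℝ≥0) (r : ℝ),
      LipschitzWith L γ ∧ 0 < r ∧
        ∀ z ∈ Metric.ball x r, z ∈ D ↔ γ (fun j => T z j) < T z i

/-- The surface measure `dS` on `∂D`: the `(d-1)`-dimensional Hausdorff measure (normalized to agree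
with Lebesgue measure on hyperplanes), restricted to the boundary. -/
def surface {d : ℕ} (D : Set (EuclideanSpace ℝ (Fin d))) :
    Measure (EuclideanSpace ℝ (Fin d)) :=
  (Measure.euclideanHausdorffMeasure (d - 1)).restrict (frontier D)

/-! ### The Sobolev space `H¹(D)` and traces -/

/-- `g` is the weak gradient of `v` on the open set `D`. -/
def HasWeakGradient {d : ℕ} (D : Set (EuclideanSpace ℝ (Fin d)))
    (v : EuclideanSpace ℝ (Fin d) → ℝ)
    (g : EuclideanSpace ℝ (Fin d) → EuclideanSpace ℝ (Fin d)) : Prop :=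
  ∀ φ : EuclideanSpace ℝ (Fin d) → ℝ, ContDiff ℝ (⊤ : ℕ∞) φ → HasCompactSupport φ → tsupport φ ⊆ D →
    ∀ i : Fin d, ∫ x in D, v x * gradient φ x i = - ∫ x in D, g x i * φ x

/-- `h` is the boundary trace of the function `v` with gradient `g`: there are functions `φ n`,
smooth up to the boundary, which converge to `v` in `H¹(D)` and whose restrictions to `∂D` converge
to `h` in `L²(∂D)`. (On a bounded Lipschitz domain every `v ∈ H¹(D)` has exactly one trace in this
sense, since smooth functions are dense in `H¹(D)` and restriction to `∂D` is bounded.) -/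
def HasTrace {d : ℕ} (D : Set (EuclideanSpace ℝ (Fin d)))
    (v : EuclideanSpace ℝ (Fin d) → ℝ)
    (g : EuclideanSpace ℝ (Fin d) → EuclideanSpace ℝ (Fin d))
    (h : EuclideanSpace ℝ (Fin d) → ℝ) : Prop :=
  ∃ φ : ℕ → EuclideanSpace ℝ (Fin d) → ℝ, (∀ n, ContDiff ℝ (⊤ : ℕ∞) (φ n)) ∧
    Tendsto (fun n => eLpNorm (φ n - v) 2 (volume.restrict D)) atTop (𝓝 0) ∧
    Tendsto (fun n => eLpNorm (gradient (φ n) - g) 2 (volume.restrict D)) atTop (𝓝 0) ∧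
    Tendsto (fun n => eLpNorm (φ n - h) 2 (surface D)) atTop (𝓝 0)

/-- A function of `H¹(D)`, given together with its weak gradient and its boundary trace. -/
structure H1Fun {d : ℕ} (D : Set (EuclideanSpace ℝ (Fin d))) where
  val : EuclideanSpace ℝ (Fin d) → ℝ
  grad : EuclideanSpace ℝ (Fin d) → EuclideanSpace ℝ (Fin d)
  trace : EuclideanSpace ℝ (Fin d) → ℝ
  memLp_val : MemLp val 2 (volume.restrict D)
  memLp_grad : MemLp grad 2 (volume.restrict D)
  hasWeakGradient : HasWeakGradient D val grad
  memLp_trace : MemLp trace 2 (surface D)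
  hasTrace : HasTrace D val grad trace

/-! ### The smoothened complete electrode model -/

/-- `E_1, …, E_K` are electrodes on `∂D`: pairwise disjoint, nonempty, connected, relatively open
subsets of the boundary. -/
structure IsElectrodes {d K : ℕ} (D : Set (EuclideanSpace ℝ (Fin d)))
    (E : Fin K → Set (EuclideanSpace ℝ (Fin d))) : Prop where
  subset_frontier : ∀ k, E k ⊆ frontier D
  relatively_open : ∀ k, ∃ O : Set (EuclideanSpace ℝ (Fin d)), IsOpen O ∧ E k = O ∩ frontier D
  isConnected : ∀ k, IsConnected (E k)
  disjoint : Pairwise fun k l => Disjoint (E k) (E l)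

/-- `ζ ∈ L^∞(∂D)` is a contact admittance: nonnegative, zero outside the electrodes, and not
identically zero on any electrode (all in the almost everywhere sense of `L^∞(∂D)`). -/
structure IsContactAdmittance {d K : ℕ} (D : Set (EuclideanSpace ℝ (Fin d)))
    (E : Fin K → Set (EuclideanSpace ℝ (Fin d))) (ζ : EuclideanSpace ℝ (Fin d) → ℝ) : Prop where
  memLp_top : MemLp ζ (⊤ : ℝ≥0∞) (surface D)
  nonneg : ∀ᵐ x ∂(surface D), 0 ≤ ζ x
  eq_zero : ∀ᵐ x ∂(surface D), x ∉ ⋃ k, E k → ζ x = 0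
  not_zero : ∀ k, ¬ ∀ᵐ x ∂(surface D), x ∈ E k → ζ x = 0

/-- The piecewise constant function `∑ V_k 1_{E_k}` attached to a voltage vector `V`. -/
def electrodeFun {d K : ℕ} (E : Fin K → Set (EuclideanSpace ℝ (Fin d)))
    (V : EuclideanSpace ℝ (Fin K)) (x : EuclideanSpace ℝ (Fin d)) : ℝ :=
  ∑ k, V k * (E k).indicator 1 x

/-- The bilinear form
`B((v,V),(w,W);σ) = ∫_D σ ∇v·∇w dx + ∫_{∂D} ζ (V - v)(W - w) dS`. -/
def form {d K : ℕ} (D : Set (EuclideanSpace ℝ (Fin d)))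
    (E : Fin K → Set (EuclideanSpace ℝ (Fin d))) (ζ σ : EuclideanSpace ℝ (Fin d) → ℝ)
    (v : H1Fun D) (V : EuclideanSpace ℝ (Fin K)) (w : H1Fun D) (W : EuclideanSpace ℝ (Fin K)) : ℝ :=
  (∫ x in D, σ x * inner ℝ (v.grad x) (w.grad x)) +
    ∫ x, ζ x * (electrodeFun E V x - v.trace x) * (electrodeFun E W x - w.trace x) ∂(surface D)

/-- `V` is the (grounded) vector of electrode voltages for the conductivity `σ` and the current
pattern `I`: `V_1 + ⋯ + V_K = 0`, and for some `v ∈ H¹(D)` the pair `(v, V)` is a weak solution,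
`B((v,V),(w,W);σ) = I·W` for all `(w,W)`. -/
def IsVoltage {d K : ℕ} (D : Set (EuclideanSpace ℝ (Fin d)))
    (E : Fin K → Set (EuclideanSpace ℝ (Fin d))) (ζ σ : EuclideanSpace ℝ (Fin d) → ℝ)
    (I V : EuclideanSpace ℝ (Fin K)) : Prop :=
  ∑ k, V k = 0 ∧ ∃ v : H1Fun D, ∀ (w : H1Fun D) (W : EuclideanSpace ℝ (Fin K)),
    form D E ζ σ v V w W = ∑ k, I k * W k

/-- The voltage vector `V(σ) = R(σ) I`. -/
def voltage {d K : ℕ} (D : Set (EuclideanSpace ℝ (Fin d)))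
    (E : Fin K → Set (EuclideanSpace ℝ (Fin d))) (ζ σ : EuclideanSpace ℝ (Fin d) → ℝ)
    (I : EuclideanSpace ℝ (Fin K)) : EuclideanSpace ℝ (Fin K) :=
  Classical.epsilon (IsVoltage D E ζ σ I)

/-! ### The parametrization, the forward map and the prior -/

/-- The parameter space `U = [-1,1]^ℕ`, with its product σ-algebra. -/
abbrev ParamSpace : Type := ℕ → Set.Icc (-1 : ℝ) 1

/-- The space `ℝ^{K(K-1)}` of data: `K - 1` voltage vectors of length `K`. -/
abbrev DataSpace (K : ℕ) : Type := EuclideanSpace ℝ (Fin (K - 1) × Fin K)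

/-- The affine parametric conductivity `σ(x,y) = σ̄(x) + ∑ y_j ψ_j(x)`. -/
def conductivity {d : ℕ} (σbar : EuclideanSpace ℝ (Fin d) → ℝ)
    (ψ : ℕ → EuclideanSpace ℝ (Fin d) → ℝ) (y : ParamSpace) (x : EuclideanSpace ℝ (Fin d)) : ℝ :=
  σbar x + ∑' j, (y j : ℝ) * ψ j x

/-- `σ̄, ψ_j ∈ L^∞(D)`, and the series defining `σ(x,y)` converges with
`0 < σ⁻ ≤ σ(x,y) ≤ σ⁺` for (almost) all `x ∈ D` and all `y ∈ U`. -/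
structure IsUniformlyElliptic {d : ℕ} (D : Set (EuclideanSpace ℝ (Fin d)))
    (σbar : EuclideanSpace ℝ (Fin d) → ℝ) (ψ : ℕ → EuclideanSpace ℝ (Fin d) → ℝ)
    (σmin σmax : ℝ) : Prop where
  memLp_σbar : MemLp σbar (⊤ : ℝ≥0∞) (volume.restrict D)
  memLp_ψ : ∀ j, MemLp (ψ j) (⊤ : ℝ≥0∞) (volume.restrict D)
  σmin_pos : 0 < σmin
  bounds : ∀ᵐ x ∂(volume.restrict D), ∀ y : ParamSpace,
    Summable (fun j => (y j : ℝ) * ψ j x) ∧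
      σmin ≤ conductivity σbar ψ y x ∧ conductivity σbar ψ y x ≤ σmax

/-- The forward map `𝒢(y) = (V^{(1)}(σ(·,y)), …, V^{(K-1)}(σ(·,y)))`. -/
def forwardMap {d K : ℕ} (D : Set (EuclideanSpace ℝ (Fin d)))
    (E : Fin K → Set (EuclideanSpace ℝ (Fin d))) (ζ σbar : EuclideanSpace ℝ (Fin d) → ℝ)
    (ψ : ℕ → EuclideanSpace ℝ (Fin d) → ℝ) (I : Fin (K - 1) → EuclideanSpace ℝ (Fin K))
    (y : ParamSpace) : DataSpace K :=
  WithLp.toLp 2 fun p => voltage D E ζ (conductivity σbar ψ y) (I p.1) p.2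

/-- The uniform distribution `dy / 2` on `[-1,1]`. -/
def uniformIcc : Measure (Set.Icc (-1 : ℝ) 1) :=
  (2⁻¹ : ℝ≥0∞) • (volume : Measure ℝ).comap Subtype.val

instance : IsProbabilityMeasure uniformIcc where
  measure_univ := by
    have h : ((volume : Measure ℝ).comap (Subtype.val : Set.Icc (-1 : ℝ) 1 → ℝ)) Set.univ = 2 := by
      rw [comap_subtype_coe_apply measurableSet_Icc, Set.image_univ, Subtype.range_coe,
        Real.volume_Icc]
      norm_num
    rw [uniformIcc, Measure.smul_apply, h, smul_eq_mul]
    exact ENNReal.inv_mul_cancel (by norm_num) (by norm_num)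

instance : Nonempty (Set.Icc (-1 : ℝ) 1) := ⟨⟨0, by norm_num, by norm_num⟩⟩

/-- The prior `μ₀ = ⨂ dy_j / 2` on `U`. -/
def prior : Measure ParamSpace := Measure.infinitePi fun _ => uniformIcc

instance : IsProbabilityMeasure prior := by unfold prior; infer_instance

section Misfit

open scoped MatrixOrder

/-- The misfit function `Φ(y;δ) = ½ |S^{-1/2} (δ - 𝒢(y))|²`, for a forward map `𝒢` and the noise
covariance matrix `S`. -/
def misfit {K : ℕ} (G : ParamSpace → DataSpace K)
    (S : Matrix (Fin (K - 1) × Fin K) (Fin (K - 1) × Fin K) ℝ)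
    (y : ParamSpace) (δ : DataSpace K) : ℝ :=
  1 / 2 * ‖Matrix.toEuclideanCLM (𝕜 := ℝ) (CFC.sqrt S)⁻¹ (δ - G y)‖ ^ 2

end Misfit

end EIT

end

/-!
The theorem splits into a deterministic part, the well-posedness of the electrode model and the
continuity of its solution in the parameters, and Bayes' formula.

**The electrode model.** The triples (function, gradient, trace) of `H1Fun` form, together with the
voltages, the closure `energySpace` of the smooth elements in a product of `L²` spaces
(`H1Fun.toEnergy_mem`, `exists_toEnergy_eq`), hence a Hilbert space. The form `B` of the model
vanishes on the pair of constants `(1, 1)`; after adding the penalty `(∑ V_k) (∑ W_k)` it becomes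
coercive (`exists_coercive`), with a constant that depends on the conductivity only through its
lower bound. Lax–Milgram solves the penalized problem, and testing with `(1, 1)` shows that its
solution is grounded, so that the penalty vanishes and the solution solves the original problem
(`isVoltage_iff`).

**The Poincaré inequality.** Coercivity needs that, up to a constant, a smooth function and its
boundary values are controlled in `L²(D)` and `L²(∂D)` by the gradient. Both are treated at once by
working with the measure `volume.restrict D + surface D` (`IsPoincareSet`). Two overlapping sets
with such an inequality can be merged, so by compactness and connectedness the inequality is local
(`isPoincareSet_closure`). Near a boundary point, the domain lies above a Lipschitz graph and is
star-shaped with respect to a ball above that point, which gives the inequality in the domain by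
integrating over segments (`isPoincareSet_of_segments`). On the boundary, the values are compared
with those slightly above; integrating the surface measure in the upward direction yields a measure
dominated by Lebesgue measure (`lintegral_surface_upward_le`), since Lipschitz maps do not increase
Hausdorff measures by more than a factor.

**Measurability.** For almost all `x` the series of the `ψ_j(x)` converges absolutely, so `σ(x, y)`
is continuous in `y`. By dominated convergence and uniform coercivity the solutions depend
continuously on `y` (`continuous_forwardMap`), and `[-1,1]^ℕ` carries its Borel σ-algebra.

**Bayes' formula.** The Gaussian noise has a density proportional to `exp (-½|S^{-1/2} z|²)` with
respect to a translation invariant measure `ρ` (`exists_multivariateGaussian_eq_withDensity`). By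
translation invariance the joint law of data and parameter has density proportional to `exp (-Φ)`
with respect to `ρ ⊗ μ₀`, and normalizing in the parameter gives the conditional distribution
(`exists_posterior`).
-/

noncomputable section

namespace EIT

/-! ### Poincaré inequalities -/

theorem sq_lintegral_le {α : Type*} [MeasurableSpace α] (μ : Measure α) {f : α → ℝ≥0∞}
    (hf : AEMeasurable f μ) : (∫⁻ x, f x ∂μ) ^ 2 ≤ μ Set.univ * ∫⁻ x, f x ^ 2 ∂μ := by
  have h := ENNReal.lintegral_mul_le_Lp_mul_Lq μ Real.HolderConjugate.two_two
    (aemeasurable_const (b := (1 : ℝ≥0∞))) hf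
  simp only [Pi.mul_apply, one_mul, lintegral_const, ENNReal.rpow_two, one_pow] at h
  calc (∫⁻ x, f x ∂μ) ^ 2
      ≤ (μ Set.univ ^ (1 / 2 : ℝ) * (∫⁻ x, f x ^ 2 ∂μ) ^ (1 / 2 : ℝ)) ^ 2 := by gcongr
    _ = _ := by
      rw [mul_pow, ← ENNReal.rpow_natCast, ← ENNReal.rpow_natCast, ← ENNReal.rpow_mul,
        ← ENNReal.rpow_mul]
      norm_num

theorem enorm_add_sq_le {F : Type*} [SeminormedAddCommGroup F] (a b : F) :
    ‖a + b‖ₑ ^ 2 ≤ 2 * ‖a‖ₑ ^ 2 + 2 * ‖b‖ₑ ^ 2 := by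
  have h : ‖a + b‖₊ ^ 2 ≤ 2 * ‖a‖₊ ^ 2 + 2 * ‖b‖₊ ^ 2 := by
    have h1 : ‖a + b‖₊ ≤ ‖a‖₊ + ‖b‖₊ := nnnorm_add_le a b
    have : (‖a + b‖₊ : ℝ) ^ 2 ≤ 2 * ‖a‖₊ ^ 2 + 2 * ‖b‖₊ ^ 2 := by
      have h2 : (‖a + b‖₊ : ℝ) ≤ ‖a‖₊ + ‖b‖₊ := by exact_mod_cast h1
      nlinarith [sq_nonneg ((‖a‖₊ : ℝ) - ‖b‖₊), (‖a + b‖₊).2]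
    exact_mod_cast this
  simp only [enorm]
  exact_mod_cast h

section Segments

variable {E : Type*} [NormedAddCommGroup E] [NormedSpace ℝ E]

/-- The fundamental theorem of calculus along a segment, combined with Jensen's inequality. -/
theorem enorm_sub_sq_le_segment {φ : E → ℝ} (hφ : ContDiff ℝ 1 φ) (x v : E) {s : ℝ} (hs : 0 ≤ s) :
    ‖φ (x + s • v) - φ x‖ₑ ^ 2 ≤
      ‖v‖ₑ ^ 2 * (ENNReal.ofReal s *
        ∫⁻ t in Set.Ioc (0 : ℝ) s, ‖fderiv ℝ φ (x + t • v)‖ₑ ^ 2) := by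
  have hd : ∀ t : ℝ, HasDerivAt (fun t : ℝ => φ (x + t • v)) (fderiv ℝ φ (x + t • v) v) t := by
    intro t
    have h1 : HasDerivAt (fun t : ℝ => x + t • v) v t := by
      simpa using ((hasDerivAt_id t).smul_const v).const_add x
    exact ((hφ.differentiable one_ne_zero _).hasFDerivAt).comp_hasDerivAt t h1
  have hc' : Continuous fun t : ℝ => fderiv ℝ φ (x + t • v) :=
    (hφ.continuous_fderiv one_ne_zero).comp (by fun_prop)
  have hc : Continuous fun t : ℝ => fderiv ℝ φ (x + t • v) v := hc'.clm_apply continuous_const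
  have hftc := intervalIntegral.integral_eq_sub_of_hasDerivAt (fun t _ => hd t)
    (hc.intervalIntegrable 0 s)
  simp only [zero_smul, add_zero] at hftc
  rw [← hftc, intervalIntegral.integral_of_le hs]
  calc ‖∫ t in Set.Ioc (0 : ℝ) s, fderiv ℝ φ (x + t • v) v‖ₑ ^ 2
      ≤ (∫⁻ t in Set.Ioc (0 : ℝ) s, ‖fderiv ℝ φ (x + t • v) v‖ₑ) ^ 2 := by
        gcongr; exact enorm_integral_le_lintegral_enorm _
    _ ≤ (∫⁻ t in Set.Ioc (0 : ℝ) s, ‖v‖ₑ * ‖fderiv ℝ φ (x + t • v)‖ₑ) ^ 2 := by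
        gcongr with t
        rw [mul_comm]
        exact ContinuousLinearMap.le_opENorm _ _
    _ = ‖v‖ₑ ^ 2 * (∫⁻ t in Set.Ioc (0 : ℝ) s, ‖fderiv ℝ φ (x + t • v)‖ₑ) ^ 2 := by
        rw [lintegral_const_mul' _ _ enorm_ne_top, mul_pow]
    _ ≤ _ := by
        gcongr
        refine (sq_lintegral_le _ hc'.enorm.measurable.aemeasurable).trans ?_
        simp

variable [FiniteDimensional ℝ E] [MeasurableSpace E] [BorelSpace E]

theorem lintegral_comp_add_smul_le (μ : Measure E) [μ.IsAddHaarMeasure] {t : ℝ} (ht : 1 / 2 ≤ t)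
    (a : E) (G : E → ℝ≥0∞) (hG : Measurable G) :
    ∫⁻ y, G (a + t • y) ∂μ ≤ 2 ^ Module.finrank ℝ E * ∫⁻ y, G y ∂μ := by
  have ht0 : 0 < t := by linarith
  have h1 : ∫⁻ y, G (a + t • y) ∂μ = ∫⁻ z, G (a + z) ∂(μ.map (t • ·)) := by
    rw [lintegral_map (by fun_prop) (by fun_prop)]
  have h2 : Measure.map (t • ·) μ = ENNReal.ofReal (|(t ^ Module.finrank ℝ E)⁻¹|) • μ :=
    Measure.map_addHaar_smul μ ht0.ne'
  rw [h1, h2, lintegral_smul_measure, lintegral_add_left_eq_self, smul_eq_mul]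
  gcongr
  rw [abs_of_pos (by positivity), ← inv_pow]
  calc ENNReal.ofReal (t⁻¹ ^ Module.finrank ℝ E) ≤ ENNReal.ofReal (2 ^ Module.finrank ℝ E) := by
        gcongr
        rw [inv_le_comm₀ ht0 (by norm_num)]
        linarith
    _ = _ := by rw [ENNReal.ofReal_pow (by norm_num)]; norm_num

/-- For a set `A` which sees every point of `B` inside `D`, the integral of `G` over all segments
from `A` to `B` is controlled by the integral over `D`: at time `t ≥ 1/2` one substitutes in the
endpoint in `B`, at time `t < 1/2` in the endpoint in `A`. -/
theorem lintegral_segments_le (μ : Measure E) [μ.IsAddHaarMeasure] {A B D : Set E} (hD : MeasurableSet D)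
    (hABD : ∀ x ∈ A, ∀ y ∈ B, ∀ t ∈ Set.Ioc (0 : ℝ) 1, x + t • (y - x) ∈ D)
    (G : E → ℝ≥0∞) (hG : Measurable G) :
    ∫⁻ y in B, ∫⁻ x in A, ∫⁻ t in Set.Ioc (0 : ℝ) 1, G (x + t • (y - x)) ∂volume ∂μ ∂μ ≤
      2 ^ Module.finrank ℝ E * (μ A + μ B) * ∫⁻ z in D, G z ∂μ := by
  set N : ℝ≥0∞ := 2 ^ Module.finrank ℝ E
  have hswap : ∫⁻ y in B, ∫⁻ x in A, ∫⁻ t in Set.Ioc (0 : ℝ) 1, G (x + t • (y - x)) ∂volume ∂μ ∂μ =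
      ∫⁻ t in Set.Ioc (0 : ℝ) 1, ∫⁻ y in B, ∫⁻ x in A, G (x + t • (y - x)) ∂μ ∂μ := by
    have h1 : ∀ y, ∫⁻ x in A, ∫⁻ t in Set.Ioc (0 : ℝ) 1, G (x + t • (y - x)) ∂volume ∂μ =
        ∫⁻ t in Set.Ioc (0 : ℝ) 1, ∫⁻ x in A, G (x + t • (y - x)) ∂μ := fun y =>
      lintegral_lintegral_swap (f := fun x t => G (x + t • (y - x)))
        (hG.comp (by fun_prop : Measurable fun p : E × ℝ => p.1 + p.2 • (y - p.1))).aemeasurable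
    simp_rw [h1]
    refine lintegral_lintegral_swap (f := fun y t => ∫⁻ x in A, G (x + t • (y - x)) ∂μ)
      (Measurable.aemeasurable ?_)
    exact Measurable.lintegral_prod_right' (f := fun p : (E × ℝ) × E =>
      G (p.2 + p.1.2 • (p.1.1 - p.2))) (hG.comp (by fun_prop))
  rw [hswap]
  have hind : Measurable (D.indicator G) := hG.indicator hD
  have key : ∀ t ∈ Set.Ioc (0 : ℝ) 1, ∫⁻ y in B, ∫⁻ x in A, G (x + t • (y - x)) ∂μ ∂μ ≤
      N * (μ A + μ B) * ∫⁻ z in D, G z ∂μ := by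
    intro t ht
    rcases le_total (1 / 2) t with h | h
    · rw [lintegral_lintegral_swap (f := fun y x => G (x + t • (y - x)))
        (hG.comp (by fun_prop : Measurable fun p : E × E =>
          p.2 + t • (p.1 - p.2))).aemeasurable]
      calc ∫⁻ x in A, ∫⁻ y in B, G (x + t • (y - x)) ∂μ ∂μ
          ≤ ∫⁻ x in A, N * ∫⁻ z in D, G z ∂μ ∂μ := by
            refine setLIntegral_mono measurable_const fun x hx => ?_
            calc ∫⁻ y in B, G (x + t • (y - x)) ∂μ
                ≤ ∫⁻ y in B, D.indicator G ((x - t • x) + t • y) ∂μ := by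
                  refine setLIntegral_mono (hind.comp (by fun_prop)) fun y hy => ?_
                  have e : x - t • x + t • y = x + t • (y - x) := by rw [smul_sub]; abel
                  rw [e, Set.indicator_of_mem (hABD x hx y hy t ht)]
              _ ≤ ∫⁻ y, D.indicator G ((x - t • x) + t • y) ∂μ := setLIntegral_le_lintegral _ _
              _ ≤ _ := by
                refine (lintegral_comp_add_smul_le μ h _ _ hind).trans ?_
                rw [lintegral_indicator hD]
        _ = N * μ A * ∫⁻ z in D, G z ∂μ := by rw [setLIntegral_const]; ring
        _ ≤ _ := by gcongr; exact le_self_add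
    · calc ∫⁻ y in B, ∫⁻ x in A, G (x + t • (y - x)) ∂μ ∂μ
          ≤ ∫⁻ y in B, N * ∫⁻ z in D, G z ∂μ ∂μ := by
            refine setLIntegral_mono measurable_const fun y hy => ?_
            calc ∫⁻ x in A, G (x + t • (y - x)) ∂μ
                ≤ ∫⁻ x in A, D.indicator G (t • y + (1 - t) • x) ∂μ := by
                  refine setLIntegral_mono (hind.comp (by fun_prop)) fun x hx => ?_
                  have e : t • y + (1 - t) • x = x + t • (y - x) := by
                    rw [smul_sub, sub_smul, one_smul]; abel
                  rw [e, Set.indicator_of_mem (hABD x hx y hy t ht)]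
              _ ≤ ∫⁻ x, D.indicator G (t • y + (1 - t) • x) ∂μ := setLIntegral_le_lintegral _ _
              _ ≤ _ := by
                refine (lintegral_comp_add_smul_le μ (by linarith) _ _ hind).trans ?_
                rw [lintegral_indicator hD]
        _ = N * μ B * ∫⁻ z in D, G z ∂μ := by rw [setLIntegral_const]; ring
        _ ≤ _ := by gcongr; exact le_add_self
  calc ∫⁻ t in Set.Ioc (0 : ℝ) 1, ∫⁻ y in B, ∫⁻ x in A, G (x + t • (y - x)) ∂μ ∂μ
      ≤ ∫⁻ _t in Set.Ioc (0 : ℝ) 1, N * (μ A + μ B) * ∫⁻ z in D, G z ∂μ :=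
        setLIntegral_mono measurable_const key
    _ = _ := by rw [setLIntegral_const]; simp

/-- The Poincaré inequality on `A`, with respect to a measure `m` on the left hand side and with the
gradient taken on the possibly larger set `D`. Since `m` may charge the boundary of `D`, this covers
trace inequalities as well. -/
def IsPoincareSet (μ m : Measure E) (D A : Set E) : Prop :=
  ∃ C : ℝ≥0∞, C ≠ ⊤ ∧ ∀ φ : E → ℝ, ContDiff ℝ 1 φ → ∃ c : ℝ,
    ∫⁻ x in A, ‖φ x - c‖ₑ ^ 2 ∂m ≤ C * ∫⁻ x in D, ‖fderiv ℝ φ x‖ₑ ^ 2 ∂μ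

omit [FiniteDimensional ℝ E] in
theorem measurable_enorm_fderiv_sq {φ : E → ℝ} (hφ : ContDiff ℝ 1 φ) :
    Measurable fun x => ‖fderiv ℝ φ x‖ₑ ^ 2 :=
  ((hφ.continuous_fderiv one_ne_zero).enorm.measurable).pow_const 2

/-- A set which is star-shaped with respect to all points of a set `B` of positive measure satisfies
the Poincaré inequality; the constant `c` is the value of `φ` at a suitable point of `B`. -/
theorem isPoincareSet_of_segments (μ : Measure E) [μ.IsAddHaarMeasure] {A B D : Set E}
    (hA : MeasurableSet A) (hB : MeasurableSet B) (hD : MeasurableSet D)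
    (hAb : Bornology.IsBounded A) (hBb : Bornology.IsBounded B) (hB0 : μ B ≠ 0)
    (hABD : ∀ x ∈ A, ∀ y ∈ B, ∀ t ∈ Set.Ioc (0 : ℝ) 1, x + t • (y - x) ∈ D) :
    IsPoincareSet μ μ D A := by
  obtain ⟨R, hR⟩ : ∃ R : ℝ, ∀ x ∈ A, ∀ y ∈ B, ‖y - x‖ ≤ R := by
    obtain ⟨R, hR⟩ := (Metric.isBounded_iff.1 (hAb.union hBb))
    refine ⟨R, fun x hx y hy => ?_⟩
    rw [← dist_eq_norm]
    exact hR (Or.inr hy) (Or.inl hx)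
  have hBt : μ B ≠ ⊤ := hBb.measure_lt_top.ne
  have hAt : μ A ≠ ⊤ := hAb.measure_lt_top.ne
  refine ⟨ENNReal.ofReal R ^ 2 * (2 ^ Module.finrank ℝ E * (μ A + μ B)) / μ B, ?_, ?_⟩
  · exact ENNReal.div_ne_top (by finiteness) hB0
  intro φ hφ
  have hm : Measurable fun p : E × E => ‖φ p.2 - φ p.1‖ₑ ^ 2 := by
    have h := hφ.continuous
    exact (by fun_prop : Continuous fun p : E × E => φ p.2 - φ p.1).enorm.measurable.pow_const 2
  set N : ℝ≥0∞ := 2 ^ Module.finrank ℝ E * (μ A + μ B)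
  set Q : ℝ≥0∞ := ∫⁻ x in D, ‖fderiv ℝ φ x‖ₑ ^ 2 ∂μ
  have hG := measurable_enorm_fderiv_sq hφ
  have hI : ∫⁻ y in B, ∫⁻ x in A, ‖φ x - φ y‖ₑ ^ 2 ∂μ ∂μ ≤ ENNReal.ofReal R ^ 2 * N * Q := by
    calc ∫⁻ y in B, ∫⁻ x in A, ‖φ x - φ y‖ₑ ^ 2 ∂μ ∂μ
        ≤ ∫⁻ y in B, ∫⁻ x in A, ENNReal.ofReal R ^ 2 *
            ∫⁻ t in Set.Ioc (0 : ℝ) 1, ‖fderiv ℝ φ (x + t • (y - x))‖ₑ ^ 2 ∂volume ∂μ ∂μ := by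
          refine setLIntegral_mono' hB fun y hy => setLIntegral_mono' hA fun x hx => ?_
          rw [← enorm_neg, neg_sub]
          have h := enorm_sub_sq_le_segment hφ x (y - x) zero_le_one
          rw [one_smul, add_sub_cancel, ENNReal.ofReal_one, one_mul] at h
          refine h.trans ?_
          gcongr
          rw [← ofReal_norm]
          exact ENNReal.ofReal_le_ofReal (hR x hx y hy)
      _ = ENNReal.ofReal R ^ 2 * ∫⁻ y in B, ∫⁻ x in A,
            ∫⁻ t in Set.Ioc (0 : ℝ) 1, ‖fderiv ℝ φ (x + t • (y - x))‖ₑ ^ 2 ∂volume ∂μ ∂μ := by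
          rw [← lintegral_const_mul' _ _ (by finiteness)]
          refine lintegral_congr fun y => ?_
          rw [← lintegral_const_mul' _ _ (by finiteness)]
      _ ≤ ENNReal.ofReal R ^ 2 * (N * Q) := by
          gcongr
          exact lintegral_segments_le μ hD hABD _ hG
      _ = _ := by ring
  have hC : ENNReal.ofReal R ^ 2 * N / μ B * Q = ENNReal.ofReal R ^ 2 * N * Q / μ B :=
    (ENNReal.mul_div_right_comm).symm
  rw [hC]
  -- some `y ∈ B` does not do worse than the average over `B`
  obtain ⟨y, -, hy⟩ := exists_le_setLAverage (f := fun y => ∫⁻ x in A, ‖φ x - φ y‖ₑ ^ 2 ∂μ)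
    hB0 hBt (hm.lintegral_prod_right' (ν := μ.restrict A)).aemeasurable
  refine ⟨φ y, hy.trans ?_⟩
  rw [setLAverage_eq]
  exact ENNReal.div_le_div_right hI _

omit [FiniteDimensional ℝ E] in
/-- Two overlapping sets with Poincaré inequalities can be merged. -/
theorem IsPoincareSet.union {μ m : Measure E} [IsFiniteMeasure m] {D A B : Set E}
    (hA : IsPoincareSet μ m D A) (hB : IsPoincareSet μ m D B) (h0 : m (A ∩ B) ≠ 0) :
    IsPoincareSet μ m D (A ∪ B) := by
  obtain ⟨C₁, hC₁, h₁⟩ := hA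
  obtain ⟨C₂, hC₂, h₂⟩ := hB
  refine ⟨C₁ + 2 * (C₂ + m B * ((2 * C₁ + 2 * C₂) / m (A ∩ B))), ?_, fun φ hφ => ?_⟩
  · have : (2 * C₁ + 2 * C₂) / m (A ∩ B) ≠ ⊤ := ENNReal.div_ne_top (by finiteness) h0
    finiteness
  obtain ⟨a, ha⟩ := h₁ φ hφ
  obtain ⟨b, hb⟩ := h₂ φ hφ
  have hφm : ∀ c : ℝ, Measurable fun x => ‖φ x - c‖ₑ ^ 2 := fun c =>
    ((hφ.continuous.sub continuous_const).enorm.measurable).pow_const 2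
  set Q : ℝ≥0∞ := ∫⁻ x in D, ‖fderiv ℝ φ x‖ₑ ^ 2 ∂μ
  -- the two constants differ by little, since both are close to `φ` on the intersection
  have hab : ‖b - a‖ₑ ^ 2 ≤ (2 * C₁ + 2 * C₂) / m (A ∩ B) * Q := by
    rw [← ENNReal.mul_div_right_comm, ENNReal.le_div_iff_mul_le (Or.inl h0) (Or.inl (by finiteness))]
    calc ‖b - a‖ₑ ^ 2 * m (A ∩ B) = ∫⁻ x in A ∩ B, ‖b - a‖ₑ ^ 2 ∂m := by rw [setLIntegral_const]
      _ ≤ ∫⁻ x in A ∩ B, (2 * ‖φ x - a‖ₑ ^ 2 + 2 * ‖φ x - b‖ₑ ^ 2) ∂m := by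
        refine lintegral_mono fun x => ?_
        have e : b - a = (φ x - a) + -(φ x - b) := by ring
        have h := enorm_add_sq_le (φ x - a) (-(φ x - b))
        rwa [← e, enorm_neg] at h
      _ = 2 * ∫⁻ x in A ∩ B, ‖φ x - a‖ₑ ^ 2 ∂m + 2 * ∫⁻ x in A ∩ B, ‖φ x - b‖ₑ ^ 2 ∂m := by
        rw [lintegral_add_left ((hφm a).const_mul 2), lintegral_const_mul _ (hφm a),
          lintegral_const_mul _ (hφm b)]
      _ ≤ 2 * (C₁ * Q) + 2 * (C₂ * Q) := by
        gcongr
        · exact (lintegral_mono_set Set.inter_subset_left).trans ha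
        · exact (lintegral_mono_set Set.inter_subset_right).trans hb
      _ = _ := by ring
  refine ⟨a, (lintegral_union_le _ _ _).trans ?_⟩
  have hB' : ∫⁻ x in B, ‖φ x - a‖ₑ ^ 2 ∂m ≤ 2 * ∫⁻ x in B, ‖φ x - b‖ₑ ^ 2 ∂m +
      2 * (‖b - a‖ₑ ^ 2 * m B) := by
    rw [← setLIntegral_const, ← lintegral_const_mul _ (hφm b),
      ← lintegral_const_mul _ measurable_const, ← lintegral_add_left ((hφm b).const_mul 2)]
    refine lintegral_mono fun x => ?_
    have h := enorm_add_sq_le (φ x - b) (b - a)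
    rwa [sub_add_sub_cancel] at h
  calc _ ≤ C₁ * Q + (2 * (C₂ * Q) + 2 * ((2 * C₁ + 2 * C₂) / m (A ∩ B) * Q * m B)) := by
        gcongr
        exact hB'.trans (by gcongr)
    _ = _ := by ring

omit [FiniteDimensional ℝ E] [BorelSpace E] in
theorem IsPoincareSet.mono {μ m : Measure E} {D A B : Set E} (h : IsPoincareSet μ m D A)
    (hBA : B ⊆ A) : IsPoincareSet μ m D B := by
  obtain ⟨C, hC, h⟩ := h
  refine ⟨C, hC, fun φ hφ => ?_⟩
  obtain ⟨c, hc⟩ := h φ hφ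
  exact ⟨c, (lintegral_mono_set hBA).trans hc⟩

omit [FiniteDimensional ℝ E] in
/-- A connected open set `D` whose (compact) closure is covered by open sets with Poincaré
inequalities satisfies a Poincaré inequality on its closure: a maximal subfamily of a finite cover
whose union has a Poincaré inequality cannot miss a member which it meets inside `D`. -/
theorem isPoincareSet_closure {μ m : Measure E} [IsFiniteMeasure m] {D : Set E}
    (hDc : IsConnected D) (hDk : IsCompact (closure D))
    (hm : ∀ O : Set E, IsOpen O → (O ∩ D).Nonempty → m O ≠ 0)
    (hloc : ∀ x ∈ closure D, ∃ A, IsOpen A ∧ x ∈ A ∧ IsPoincareSet μ m D A) :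
    IsPoincareSet μ m D (closure D) := by
  classical
  choose! A hAo hxA hA using hloc
  obtain ⟨t, htD, ht⟩ := hDk.elim_nhds_subcover A (fun x hx => (hAo x hx).mem_nhds (hxA x hx))
  have hmeet : ∀ x ∈ t, (D ∩ A x).Nonempty := fun x hx => by
    rw [Set.inter_comm]
    exact mem_closure_iff.1 (htD x hx) _ (hAo x (htD x hx)) (hxA x (htD x hx))
  have hopen : ∀ s ⊆ t, IsOpen (⋃ x ∈ s, A x) := fun s hs =>
    isOpen_biUnion fun x hx => hAo x (htD x (hs hx))
  obtain ⟨x₀, hx₀⟩ : t.Nonempty := by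
    by_contra h
    rw [Finset.not_nonempty_iff_eq_empty] at h
    obtain ⟨z, hz⟩ := hDc.nonempty
    simpa [h] using ht (subset_closure hz)
  obtain ⟨s, hs, hmax⟩ := Finset.exists_max_image
    (t.powerset.filter fun s => s.Nonempty ∧ IsPoincareSet μ m D (⋃ x ∈ s, A x)) Finset.card
    ⟨{x₀}, by simpa [hx₀] using hA x₀ (htD x₀ hx₀)⟩
  simp only [Finset.mem_filter, Finset.mem_powerset] at hs hmax
  obtain ⟨hst, ⟨x₁, hx₁⟩, hsP⟩ := hs
  have hall : t ⊆ s := by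
    by_contra hts
    obtain ⟨x₂, hx₂t, hx₂s⟩ := Finset.not_subset.1 hts
    have hpre := hDc.isPreconnected (⋃ x ∈ s, A x) (⋃ x ∈ t \ s, A x) (hopen s hst)
      (hopen _ Finset.sdiff_subset) ?_ ?_ ?_
    · obtain ⟨z, hzD, hzs, hzt⟩ := hpre
      obtain ⟨x, hx, hzx⟩ := Set.mem_iUnion₂.1 hzt
      obtain ⟨hxt, hxs⟩ := Finset.mem_sdiff.1 hx
      have hU : IsPoincareSet μ m D (⋃ y ∈ insert x s, A y) := by
        rw [Finset.set_biUnion_insert, Set.union_comm]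
        exact hsP.union (hA x (htD x hxt))
          (hm _ ((hopen s hst).inter (hAo x (htD x hxt))) ⟨z, ⟨hzs, hzx⟩, hzD⟩)
      have := hmax (insert x s) ⟨Finset.insert_subset hxt hst, Finset.insert_nonempty _ _, hU⟩
      rw [Finset.card_insert_of_notMem hxs] at this
      omega
    · intro z hz
      obtain ⟨x, hx, hzx⟩ := Set.mem_iUnion₂.1 (ht (subset_closure hz))
      by_cases hxs : x ∈ s
      · exact Or.inl (Set.mem_biUnion hxs hzx)
      · exact Or.inr (Set.mem_biUnion (Finset.mem_coe.2 (Finset.mem_sdiff.2 ⟨hx, hxs⟩)) hzx)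
    · exact (hmeet x₁ (hst hx₁)).mono
        (Set.inter_subset_inter_right _ (Set.subset_biUnion_of_mem (u := A) hx₁))
    · exact (hmeet x₂ hx₂t).mono (Set.inter_subset_inter_right _
        (Set.subset_biUnion_of_mem (u := A) (Finset.mem_coe.2 (Finset.mem_sdiff.2 ⟨hx₂t, hx₂s⟩))))
  exact hsP.mono (ht.trans (Set.biUnion_subset_biUnion_left hall))

end Segments

/-! ### Lipschitz boundary charts -/

section Charts

variable {d : ℕ}

/-- The coordinates of `z` other than the `i`-th one, after the rotation `T`. -/
def horizontal (T : EuclideanSpace ℝ (Fin d) ≃ₗᵢ[ℝ] EuclideanSpace ℝ (Fin d)) (i : Fin d)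
    (z : EuclideanSpace ℝ (Fin d)) : {j : Fin d // j ≠ i} → ℝ := fun j => T z j

/-- The upward unit vector of the coordinate system given by `T` and `i`. -/
def upward (T : EuclideanSpace ℝ (Fin d) ≃ₗᵢ[ℝ] EuclideanSpace ℝ (Fin d)) (i : Fin d) :
    EuclideanSpace ℝ (Fin d) := T.symm (EuclideanSpace.single i 1)

/-- The point with horizontal coordinates `p.1` and height `p.2`. -/
def chart (T : EuclideanSpace ℝ (Fin d) ≃ₗᵢ[ℝ] EuclideanSpace ℝ (Fin d)) (i : Fin d)
    (p : ({j : Fin d // j ≠ i} → ℝ) × ℝ) : EuclideanSpace ℝ (Fin d) :=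
  T.symm (WithLp.toLp 2 fun j => if h : j ≠ i then p.1 ⟨j, h⟩ else p.2)

variable (T : EuclideanSpace ℝ (Fin d) ≃ₗᵢ[ℝ] EuclideanSpace ℝ (Fin d)) (i : Fin d)

theorem norm_upward : ‖upward T i‖ = 1 := by simp [upward]

theorem apply_add_smul_upward (z : EuclideanSpace ℝ (Fin d)) (s : ℝ) :
    T (z + s • upward T i) i = T z i + s := by simp [upward]

theorem horizontal_add_smul_upward (z : EuclideanSpace ℝ (Fin d)) (s : ℝ) :
    horizontal T i (z + s • upward T i) = horizontal T i z := by
  ext j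
  simp [horizontal, upward, j.2]

theorem horizontal_add_smul_sub (x y : EuclideanSpace ℝ (Fin d)) (t : ℝ) :
    horizontal T i (x + t • (y - x)) =
      horizontal T i x + t • (horizontal T i y - horizontal T i x) := by
  ext j
  simp [horizontal]

theorem norm_horizontal_sub_le (x y : EuclideanSpace ℝ (Fin d)) :
    ‖horizontal T i x - horizontal T i y‖ ≤ ‖x - y‖ := by
  rw [pi_norm_le_iff_of_nonneg (norm_nonneg _)]
  intro j
  have h := PiLp.norm_apply_le (T (x - y)) (j : Fin d)
  rw [T.norm_map] at h
  simpa [horizontal] using h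

theorem abs_apply_sub_le (x y : EuclideanSpace ℝ (Fin d)) : |T x i - T y i| ≤ ‖x - y‖ := by
  have h := PiLp.norm_apply_le (T (x - y)) i
  rw [T.norm_map] at h
  simpa using h

theorem continuous_horizontal : Continuous (horizontal T i) := by
  unfold horizontal; fun_prop

theorem chart_horizontal (z : EuclideanSpace ℝ (Fin d)) : chart T i (horizontal T i z, T z i) = z := by
  rw [chart, LinearIsometryEquiv.symm_apply_eq]
  ext j
  by_cases h : j = i <;> simp [horizontal, h]

theorem chart_add (p : {j : Fin d // j ≠ i} → ℝ) (t s : ℝ) :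
    chart T i (p, t + s) = chart T i (p, t) + s • upward T i := by
  rw [chart, chart, upward, ← map_smul, ← map_add]
  congr 1
  ext j
  by_cases h : j = i <;> simp [h]

theorem measurePreserving_chart : MeasurePreserving (chart T i) := by
  have h1 := (volume_preserving_piEquivPiSubtypeProd (fun _ : Fin d => ℝ) (fun j => j ≠ i)).symm
  let _ : Unique {j : Fin d // ¬ j ≠ i} :=
    ⟨⟨⟨i, by simp⟩⟩, fun j => Subtype.ext (by simpa using j.2)⟩
  have h2 := (volume_preserving_funUnique {j : Fin d // ¬ j ≠ i} ℝ).symm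
  have h3 : MeasurePreserving (Prod.map id (MeasurableEquiv.funUnique {j : Fin d // ¬ j ≠ i} ℝ).symm)
      (volume : Measure (({j : Fin d // j ≠ i} → ℝ) × ℝ)) volume := by
    have h := (MeasurePreserving.id (volume : Measure ({j : Fin d // j ≠ i} → ℝ))).prod h2
    convert h <;> first | rfl | skip
    refine (Measure.volume_eq_prod _ _).trans ?_
    congr!
  have h := (T.symm.measurePreserving.comp (PiLp.volume_preserving_toLp (Fin d))).comp (h1.comp h3)
  have e : chart T i = (T.symm ∘ WithLp.toLp 2) ∘
      (MeasurableEquiv.piEquivPiSubtypeProd (fun _ : Fin d => ℝ) fun j => j ≠ i).symm ∘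
        Prod.map id (MeasurableEquiv.funUnique {j : Fin d // ¬ j ≠ i} ℝ).symm := by
    ext p
    rfl
  rw [e]
  exact h

theorem exists_lipschitzWith_chart_graph {γ : ({j : Fin d // j ≠ i} → ℝ) → ℝ} {L : ℝ≥0}
    (hγ : LipschitzWith L γ) : ∃ K, LipschitzWith K fun p => chart T i (p, γ p) := by
  have h1 : LipschitzWith 1 fun (p : ({j : Fin d // j ≠ i} → ℝ) × ℝ) (j : Fin d) =>
      if h : j ≠ i then p.1 ⟨j, h⟩ else p.2 := by
    refine LipschitzWith.of_dist_le_mul fun p q => ?_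
    rw [NNReal.coe_one, one_mul, dist_pi_le_iff dist_nonneg]
    intro j
    by_cases h : j = i
    · simp only [ne_eq, h, not_true_eq_false, dif_neg, not_false_eq_true]
      exact le_max_right _ _
    · simp only [ne_eq, h, not_false_eq_true, dif_pos]
      exact (dist_le_pi_dist p.1 q.1 _).trans (le_max_left _ _)
  exact ⟨_, (T.symm.lipschitz.comp ((PiLp.lipschitzWith_toLp 2 _).comp h1)).comp
    (LipschitzWith.id.prodMk hγ)⟩


/-- The part of the boundary inside a set `O` where it is the graph of a Lipschitz function `γ` has
surface measure bounded by Lebesgue measure in the horizontal coordinates. -/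
theorem surface_le_map_chart_graph {D : Set (EuclideanSpace ℝ (Fin d))}
    {γ : ({j : Fin d // j ≠ i} → ℝ) → ℝ} {L : ℝ≥0} (hγ : LipschitzWith L γ) :
    ∃ C : ℝ≥0∞, C ≠ ⊤ ∧ ∀ O : Set (EuclideanSpace ℝ (Fin d)), MeasurableSet O →
      (∀ z ∈ O, z ∈ frontier D → T z i = γ (horizontal T i z)) →
      (surface D).restrict O ≤
        C • (volume : Measure ({j : Fin d // j ≠ i} → ℝ)).map fun p => chart T i (p, γ p) := by
  obtain ⟨K, hK⟩ := exists_lipschitzWith_chart_graph T i hγ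
  have hcard : Fintype.card {j : Fin d // j ≠ i} = d - 1 := by simp
  refine ⟨(Measure.addHaarScalarFactor (volume : Measure (EuclideanSpace ℝ (Fin (d - 1))))
    (Measure.hausdorffMeasure ((d - 1 : ℕ) : ℝ)) : ℝ≥0∞) * (K : ℝ≥0∞) ^ ((d - 1 : ℕ) : ℝ), ?_, ?_⟩
  · finiteness
  intro O hO hgraph
  refine Measure.le_iff.2 fun S hS => ?_
  rw [Measure.restrict_apply hS, surface, Measure.restrict_apply (hS.inter hO),
    Measure.smul_apply, Measure.map_apply hK.continuous.measurable hS,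
    Measure.euclideanHausdorffMeasure_def, Measure.smul_apply, ENNReal.smul_def, smul_eq_mul,
    smul_eq_mul, mul_assoc]
  gcongr
  have hsub : S ∩ O ∩ frontier D ⊆
      (fun p => chart T i (p, γ p)) '' ((fun p => chart T i (p, γ p)) ⁻¹' S) := by
    rintro z ⟨⟨hzS, hzO⟩, hzD⟩
    have hz : chart T i (horizontal T i z, γ (horizontal T i z)) = z := by
      rw [← hgraph z hzO hzD, chart_horizontal]
    exact ⟨horizontal T i z, by simpa only [Set.mem_preimage, hz] using hzS, hz⟩
  refine (measure_mono hsub).trans ((hK.hausdorffMeasure_image_le (by positivity) _).trans ?_)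
  rw [← hcard, hausdorffMeasure_pi_real]

/-- Integrating over the boundary and then upwards is controlled by Lebesgue measure on the
domain. -/
theorem lintegral_surface_upward_le {D : Set (EuclideanSpace ℝ (Fin d))}
    {γ : ({j : Fin d // j ≠ i} → ℝ) → ℝ} {L : ℝ≥0} (hγ : LipschitzWith L γ) :
    ∃ C : ℝ≥0∞, C ≠ ⊤ ∧ ∀ O A : Set (EuclideanSpace ℝ (Fin d)), ∀ s : ℝ, MeasurableSet O →
      MeasurableSet A →
      (∀ z ∈ O, z ∈ frontier D → T z i = γ (horizontal T i z)) →
      (∀ z ∈ O, z ∈ frontier D → ∀ t ∈ Set.Ioc 0 s, z + t • upward T i ∈ A) →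
      ∀ G : EuclideanSpace ℝ (Fin d) → ℝ≥0∞, Measurable G →
        ∫⁻ x in O, ∫⁻ t in Set.Ioc 0 s, G (x + t • upward T i) ∂volume ∂(surface D) ≤
          C * ∫⁻ x in A, G x := by
  obtain ⟨C, hC, h⟩ := surface_le_map_chart_graph T i (D := D) hγ
  refine ⟨C, hC, fun O A s hO hA hgraph hup G hG => ?_⟩
  have hi : Measurable (A.indicator G) := hG.indicator hA
  have hF : Measurable fun p : {j : Fin d // j ≠ i} → ℝ => chart T i (p, γ p) :=
    (measurePreserving_chart T i).measurable.comp
      (measurable_id.prodMk hγ.continuous.measurable)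
  have hae : ∀ᵐ x ∂((surface D).restrict O), x ∈ O ∧ x ∈ frontier D := by
    have h1 : ∀ᵐ x ∂((surface D).restrict O), x ∈ O := ae_restrict_mem hO
    have h2 : ∀ᵐ x ∂((surface D).restrict O), x ∈ frontier D :=
      ae_restrict_of_ae (ae_restrict_mem isClosed_frontier.measurableSet)
    exact h1.and h2
  have hin : Measurable fun x => ∫⁻ t, A.indicator G (x + t • upward T i) ∂volume :=
    Measurable.lintegral_prod_right' (f := fun p : EuclideanSpace ℝ (Fin d) × ℝ =>
      A.indicator G (p.1 + p.2 • upward T i)) (hi.comp (by fun_prop))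
  calc ∫⁻ x in O, ∫⁻ t in Set.Ioc 0 s, G (x + t • upward T i) ∂volume ∂(surface D)
      ≤ ∫⁻ x in O, ∫⁻ t, A.indicator G (x + t • upward T i) ∂volume ∂(surface D) := by
        refine lintegral_mono_ae (hae.mono fun x hx => ?_)
        refine (setLIntegral_mono (g := fun t => A.indicator G (x + t • upward T i))
          (hi.comp (by fun_prop)) fun t ht => ?_).trans (setLIntegral_le_lintegral _ _)
        rw [Set.indicator_of_mem (hup x hx.1 hx.2 t ht)]
    _ ≤ ∫⁻ x, ∫⁻ t, A.indicator G (x + t • upward T i) ∂volume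
          ∂(C • (volume : Measure ({j : Fin d // j ≠ i} → ℝ)).map fun p => chart T i (p, γ p)) :=
        lintegral_mono' (h O hO hgraph) le_rfl
    _ = C * ∫⁻ p : {j : Fin d // j ≠ i} → ℝ, ∫⁻ t : ℝ, A.indicator G (chart T i (p, t)) := by
        rw [lintegral_smul_measure, lintegral_map hin hF, smul_eq_mul]
        congr 1
        refine lintegral_congr fun p => ?_
        simp_rw [← chart_add]
        exact lintegral_add_left_eq_self (fun t => A.indicator G (chart T i (p, t))) (γ p)
    _ = C * ∫⁻ x in A, G x := by
        have hc := measurePreserving_chart T i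
        rw [← lintegral_indicator hA, ← hc.lintegral_comp hi, Measure.volume_eq_prod,
          lintegral_prod]
        exact (hi.comp hc.measurable).aemeasurable

end Charts

/-! ### The Poincaré and trace inequality on a Lipschitz domain -/

section Domain

variable {d : ℕ}

/-- A point above the graph of a Lipschitz function sees, without leaving the region above the
graph, every point of the cone above it whose slope is the Lipschitz constant. -/
theorem graph_lt_of_cone (T : EuclideanSpace ℝ (Fin d) ≃ₗᵢ[ℝ] EuclideanSpace ℝ (Fin d)) (i : Fin d)
    {γ : ({j : Fin d // j ≠ i} → ℝ) → ℝ} {L : ℝ≥0} (hγ : LipschitzWith L γ)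
    {x y : EuclideanSpace ℝ (Fin d)} {t : ℝ} (ht : 0 ≤ t) (hx : γ (horizontal T i x) < T x i)
    (hxy : L * ‖horizontal T i y - horizontal T i x‖ ≤ T y i - T x i) :
    γ (horizontal T i (x + t • (y - x))) < T (x + t • (y - x)) i := by
  have h1 := hγ.dist_le_mul (horizontal T i (x + t • (y - x))) (horizontal T i x)
  rw [horizontal_add_smul_sub, dist_eq_norm, dist_eq_norm, add_sub_cancel_left, norm_smul,
    Real.norm_of_nonneg ht, Real.norm_eq_abs] at h1
  have h2 := (abs_le.1 h1).2
  have h3 : T (x + t • (y - x)) i = T x i + t * (T y i - T x i) := by simp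
  rw [horizontal_add_smul_sub, h3]
  nlinarith [mul_le_mul_of_nonneg_left hxy ht]

variable {D : Set (EuclideanSpace ℝ (Fin d))}

/-- Inside a graph chart, boundary points lie on the graph. -/
theorem apply_eq_of_mem_frontier (hDo : IsOpen D)
    (T : EuclideanSpace ℝ (Fin d) ≃ₗᵢ[ℝ] EuclideanSpace ℝ (Fin d)) (i : Fin d)
    {γ : ({j : Fin d // j ≠ i} → ℝ) → ℝ} {L : ℝ≥0} (hγ : LipschitzWith L γ)
    {O : Set (EuclideanSpace ℝ (Fin d))} (hO : IsOpen O)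
    (hD : ∀ z ∈ O, z ∈ D ↔ γ (horizontal T i z) < T z i) {z : EuclideanSpace ℝ (Fin d)}
    (hzO : z ∈ O) (hz : z ∈ frontier D) : T z i = γ (horizontal T i z) := by
  rw [hDo.frontier_eq] at hz
  refine le_antisymm (not_lt.1 fun h => hz.2 ((hD z hzO).2 h)) ?_
  have hcl : z ∈ closure {w | γ (horizontal T i w) < T w i} := by
    have h1 : z ∈ closure (O ∩ D) := hO.inter_closure ⟨hzO, hz.1⟩
    exact closure_mono (fun w hw => (hD w hw.1).1 hw.2) h1
  have hc1 : Continuous fun w => γ (horizontal T i w) :=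
    hγ.continuous.comp (continuous_horizontal T i)
  have hc2 : Continuous fun w => T w i := by fun_prop
  exact closure_lt_subset_le hc1 hc2 hcl

/-- Near a boundary point of a Lipschitz domain, the `L²` norms of `φ - c` on the domain and on the
boundary are controlled by the gradient: the domain is locally star-shaped with respect to a ball
above the boundary, and the values on the boundary are compared with those slightly above. -/
theorem IsLipschitzDomain.exists_isPoincareSet_of_mem_frontier (hD : IsLipschitzDomain D)
    {x₀ : EuclideanSpace ℝ (Fin d)} (hx₀ : x₀ ∈ frontier D) :
    ∃ A, IsOpen A ∧ x₀ ∈ A ∧ surface D A < ⊤ ∧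
      IsPoincareSet volume (volume.restrict D + surface D) D A := by
  obtain ⟨T, i, γ, L, r, hγ, hr, hgr⟩ := hD.locally_graph x₀ hx₀
  change ∀ z ∈ Metric.ball x₀ r, z ∈ D ↔ γ (horizontal T i z) < T z i at hgr
  set e := upward T i with he
  have hee : ‖e‖ = 1 := norm_upward T i
  -- so small that the cone of slope `L` above any point of `ball x₀ ρ` contains
  -- `ball (x₀ + (r / 2) e) ρ`
  set ρ : ℝ := r / (4 + 4 * L) with hρ
  have hL : (0 : ℝ) ≤ L := L.2
  have hρ0 : 0 < ρ := by positivity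
  have hρr : 4 * ρ + 4 * L * ρ = r := by rw [hρ]; field_simp
  have hLρ : 0 ≤ L * ρ := by positivity
  have hDm : MeasurableSet D := hD.isOpen.measurableSet
  -- the set `ball x₀ ρ ∩ D` is star-shaped with respect to a ball around `x₀ + (r / 2) e`
  have hstar : ∀ x ∈ Metric.ball x₀ ρ ∩ D, ∀ y ∈ Metric.ball (x₀ + (r / 2) • e) ρ,
      ∀ t ∈ Set.Ioc (0 : ℝ) 1, x + t • (y - x) ∈ D := by
    rintro x ⟨hx, hxD⟩ y hy t ht
    rw [mem_ball_iff_norm] at hx hy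
    have hxr : x ∈ Metric.ball x₀ r := by rw [mem_ball_iff_norm]; linarith
    have hyr : y ∈ Metric.ball x₀ r := by
      rw [mem_ball_iff_norm]
      calc ‖y - x₀‖ = ‖(y - (x₀ + (r / 2) • e)) + (r / 2) • e‖ := by congr 1; abel
        _ ≤ ‖y - (x₀ + (r / 2) • e)‖ + ‖(r / 2) • e‖ := norm_add_le _ _
        _ < ρ + r / 2 := by
          rw [norm_smul, hee, Real.norm_of_nonneg (by positivity)]; linarith
        _ ≤ r := by linarith
    have hseg : x + t • (y - x) ∈ Metric.ball x₀ r :=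
      (convex_ball x₀ r).add_smul_sub_mem hxr hyr ⟨ht.1.le, ht.2⟩
    refine (hgr _ hseg).2 (graph_lt_of_cone T i hγ ht.1.le ((hgr x hxr).1 hxD) ?_)
    have hn : ‖y - (x + (r / 2) • e)‖ ≤ 2 * ρ := by
      calc ‖y - (x + (r / 2) • e)‖ = ‖(y - (x₀ + (r / 2) • e)) - (x - x₀)‖ := by congr 1; abel
        _ ≤ ‖y - (x₀ + (r / 2) • e)‖ + ‖x - x₀‖ := norm_sub_le _ _
        _ ≤ 2 * ρ := by linarith
    have h1 := (norm_horizontal_sub_le T i y (x + (r / 2) • e)).trans hn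
    have h2 := (abs_apply_sub_le T i y (x + (r / 2) • e)).trans hn
    rw [he, horizontal_add_smul_upward] at h1
    rw [he, apply_add_smul_upward] at h2
    have h3 := (abs_le.1 h2).1
    nlinarith [mul_le_mul_of_nonneg_left h1 hL]
  have hvol : IsPoincareSet volume volume D (Metric.ball x₀ ρ ∩ D) :=
    isPoincareSet_of_segments volume (measurableSet_ball.inter hDm) measurableSet_ball hDm
      (Metric.isBounded_ball.subset Set.inter_subset_left) Metric.isBounded_ball
      (Metric.measure_ball_pos volume _ hρ0).ne' hstar
  obtain ⟨C₁, hC₁, h₁⟩ := hvol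
  obtain ⟨C₂, hC₂, h₂⟩ := lintegral_surface_upward_le T i (D := D) hγ
  have hgraph : ∀ z ∈ Metric.ball x₀ (ρ / 2), z ∈ frontier D → T z i = γ (horizontal T i z) := by
    intro z hz hzD
    refine apply_eq_of_mem_frontier hD.isOpen T i hγ Metric.isOpen_ball hgr ?_ hzD
    exact Metric.ball_subset_ball (by linarith) hz
  have hup : ∀ z ∈ Metric.ball x₀ (ρ / 2), z ∈ frontier D → ∀ t ∈ Set.Ioc 0 (ρ / 2),
      z + t • e ∈ Metric.ball x₀ ρ ∩ D := by
    intro z hz hzD t ht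
    have hb : z + t • e ∈ Metric.ball x₀ ρ := by
      rw [mem_ball_iff_norm] at hz ⊢
      calc ‖z + t • e - x₀‖ = ‖(z - x₀) + t • e‖ := by congr 1; abel
        _ ≤ ‖z - x₀‖ + ‖t • e‖ := norm_add_le _ _
        _ < ρ := by rw [norm_smul, hee, Real.norm_of_nonneg ht.1.le]; linarith [ht.2]
    refine ⟨hb, (hgr _ (Metric.ball_subset_ball (by linarith) hb)).2 ?_⟩
    rw [he, horizontal_add_smul_upward, apply_add_smul_upward, hgraph z hz hzD]
    linarith [ht.1]
  have h₂' := h₂ _ _ _ measurableSet_ball (measurableSet_ball.inter hDm) hgraph hup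
  have hs0 : ENNReal.ofReal (ρ / 2) ≠ 0 := by simpa using hρ0
  have hfin : surface D (Metric.ball x₀ (ρ / 2)) < ⊤ := by
    -- each boundary point contributes a vertical segment of length `ρ / 2` in the domain
    have h := h₂' (fun _ => 1) measurable_const
    simp only [setLIntegral_const, Real.volume_Ioc, sub_zero, one_mul] at h
    have h' : C₂ * volume (Metric.ball x₀ ρ ∩ D) ≠ ⊤ :=
      ENNReal.mul_ne_top hC₂ ((measure_mono Set.inter_subset_left).trans_lt
        measure_ball_lt_top).ne
    exact ENNReal.lt_top_of_mul_ne_top_right (h.trans_lt h'.lt_top).ne hs0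
  refine ⟨Metric.ball x₀ (ρ / 2), Metric.isOpen_ball, Metric.mem_ball_self (by positivity), hfin, ?_⟩
  refine ⟨C₁ + C₂ * (2 * C₁ + 2 * ENNReal.ofReal (ρ / 2) ^ 2) / ENNReal.ofReal (ρ / 2), ?_,
    fun φ hφ => ?_⟩
  · have : C₂ * (2 * C₁ + 2 * ENNReal.ofReal (ρ / 2) ^ 2) / ENNReal.ofReal (ρ / 2) ≠ ⊤ :=
      ENNReal.div_ne_top (by finiteness) hs0
    finiteness
  obtain ⟨c, hc⟩ := h₁ φ hφ
  refine ⟨c, ?_⟩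
  set Q : ℝ≥0∞ := ∫⁻ x in D, ‖fderiv ℝ φ x‖ₑ ^ 2
  set s : ℝ≥0∞ := ENNReal.ofReal (ρ / 2) with hs
  have hst : s ≠ ⊤ := ENNReal.ofReal_ne_top
  have hφm : Measurable fun x => ‖φ x - c‖ₑ ^ 2 :=
    ((hφ.continuous.sub continuous_const).enorm.measurable).pow_const 2
  have hG := measurable_enorm_fderiv_sq hφ
  rw [Measure.restrict_add, lintegral_add_measure, Measure.restrict_restrict measurableSet_ball,
    add_mul]
  gcongr
  · refine (lintegral_mono_set ?_).trans hc
    exact Set.inter_subset_inter_left _ (Metric.ball_subset_ball (by linarith))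
  rw [← ENNReal.mul_div_right_comm, ENNReal.le_div_iff_mul_le (Or.inl hs0) (Or.inl hst)]
  -- compare the value at `x` with the values at the heights `t ≤ ρ / 2` above `x`, on average
  have hpt : ∀ x, ‖φ x - c‖ₑ ^ 2 * s ≤ ∫⁻ t in Set.Ioc 0 (ρ / 2),
      (2 * ‖φ (x + t • e) - c‖ₑ ^ 2 + 2 * s ^ 2 * ‖fderiv ℝ φ (x + t • e)‖ₑ ^ 2) := by
    intro x
    have hm1 : Measurable fun t : ℝ => ‖φ (x + t • e) - c‖ₑ ^ 2 := hφm.comp (by fun_prop)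
    have hm2 : Measurable fun t : ℝ => ‖fderiv ℝ φ (x + t • e)‖ₑ ^ 2 := hG.comp (by fun_prop)
    set J := ∫⁻ t in Set.Ioc 0 (ρ / 2), ‖fderiv ℝ φ (x + t • e)‖ₑ ^ 2
    calc ‖φ x - c‖ₑ ^ 2 * s = ∫⁻ _t in Set.Ioc 0 (ρ / 2), ‖φ x - c‖ₑ ^ 2 := by
          rw [setLIntegral_const, Real.volume_Ioc, sub_zero]
      _ ≤ ∫⁻ t in Set.Ioc 0 (ρ / 2), (2 * ‖φ (x + t • e) - c‖ₑ ^ 2 + 2 * (s * J)) := by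
          refine setLIntegral_mono ((hm1.const_mul 2).add_const _) fun t ht => ?_
          have h := enorm_add_sq_le (φ (x + t • e) - c) (-(φ (x + t • e) - φ x))
          have e1 : φ (x + t • e) - c + -(φ (x + t • e) - φ x) = φ x - c := by ring
          rw [e1, enorm_neg] at h
          refine h.trans ?_
          gcongr
          refine (enorm_sub_sq_le_segment hφ x e ht.1.le).trans ?_
          have hen : ‖e‖ₑ = 1 := by rw [← ofReal_norm, hee, ENNReal.ofReal_one]
          rw [hen, one_pow, one_mul]
          gcongr
          · exact ENNReal.ofReal_le_ofReal ht.2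
          · exact lintegral_mono_set (Set.Ioc_subset_Ioc_right ht.2)
      _ = 2 * (∫⁻ t in Set.Ioc 0 (ρ / 2), ‖φ (x + t • e) - c‖ₑ ^ 2) + 2 * s ^ 2 * J := by
          rw [lintegral_add_left (hm1.const_mul 2), lintegral_const_mul _ hm1, setLIntegral_const,
            Real.volume_Ioc, sub_zero]
          ring
      _ = _ := by
          rw [lintegral_add_left (hm1.const_mul 2), lintegral_const_mul _ hm1,
            lintegral_const_mul _ hm2]
  have hH : Measurable fun x => 2 * ‖φ x - c‖ₑ ^ 2 + 2 * s ^ 2 * ‖fderiv ℝ φ x‖ₑ ^ 2 :=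
    (hφm.const_mul 2).add (hG.const_mul _)
  calc (∫⁻ x in Metric.ball x₀ (ρ / 2), ‖φ x - c‖ₑ ^ 2 ∂(surface D)) * s
      = ∫⁻ x in Metric.ball x₀ (ρ / 2), ‖φ x - c‖ₑ ^ 2 * s ∂(surface D) :=
        (lintegral_mul_const' _ _ hst).symm
    _ ≤ _ := lintegral_mono hpt
    _ ≤ C₂ * ∫⁻ x in Metric.ball x₀ ρ ∩ D,
          (2 * ‖φ x - c‖ₑ ^ 2 + 2 * s ^ 2 * ‖fderiv ℝ φ x‖ₑ ^ 2) := h₂' _ hH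
    _ ≤ C₂ * (2 * (C₁ * Q) + 2 * s ^ 2 * Q) := by
        rw [lintegral_add_left (hφm.const_mul 2), lintegral_const_mul _ hφm,
          lintegral_const_mul _ hG]
        gcongr
        exact lintegral_mono_set Set.inter_subset_right
    _ = _ := by ring

theorem IsLipschitzDomain.isFiniteMeasure_surface (hD : IsLipschitzDomain D) :
    IsFiniteMeasure (surface D) := by
  constructor
  have hk : IsCompact (frontier D) := hD.isBounded.isCompact_closure.of_isClosed_subset
    isClosed_frontier frontier_subset_closure
  have h : surface D (frontier D) < ⊤ := by
    refine hk.measure_lt_top_of_nhdsWithin fun x hx => ?_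
    obtain ⟨A, hAo, hxA, hA, -⟩ := hD.exists_isPoincareSet_of_mem_frontier hx
    exact ⟨A, mem_nhdsWithin_of_mem_nhds (hAo.mem_nhds hxA), hA⟩
  rwa [surface, Measure.restrict_apply_univ, ← Measure.restrict_apply_self]

theorem IsLipschitzDomain.volume_lt_top (hD : IsLipschitzDomain D) : volume D < ⊤ :=
  hD.isBounded.measure_lt_top

theorem IsLipschitzDomain.isPoincareSet_closure (hD : IsLipschitzDomain D) :
    IsPoincareSet volume (volume.restrict D + surface D) D (closure D) := by
  have := hD.isFiniteMeasure_surface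
  have : IsFiniteMeasure (volume.restrict D) := isFiniteMeasure_restrict.2 hD.volume_lt_top.ne
  refine EIT.isPoincareSet_closure hD.isConnected hD.isBounded.isCompact_closure ?_ ?_
  · intro O hO hne h0
    have h1 : volume (O ∩ D) = 0 := by
      rw [← Measure.restrict_apply hO.measurableSet]
      exact le_antisymm ((Measure.le_add_right le_rfl _).trans h0.le) zero_le
    exact ((hO.inter hD.isOpen).measure_pos volume hne).ne' h1
  · intro x hx
    by_cases hxD : x ∈ D
    · obtain ⟨ε, hε, hεD⟩ := Metric.isOpen_iff.1 hD.isOpen x hxD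
      refine ⟨Metric.ball x ε, Metric.isOpen_ball, Metric.mem_ball_self hε, ?_⟩
      have hP : IsPoincareSet volume volume D (Metric.ball x ε) :=
        isPoincareSet_of_segments volume measurableSet_ball measurableSet_ball
          hD.isOpen.measurableSet Metric.isBounded_ball Metric.isBounded_ball
          (Metric.measure_ball_pos volume _ hε).ne' fun y hy z hz t ht =>
            hεD ((convex_ball x ε).add_smul_sub_mem hy hz ⟨ht.1.le, ht.2⟩)
      have hm : (volume.restrict D + surface D).restrict (Metric.ball x ε) ≤
          volume.restrict (Metric.ball x ε) := by
        have h0 : (surface D).restrict (Metric.ball x ε) = 0 := by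
          rw [Measure.restrict_eq_zero, surface, Measure.restrict_apply measurableSet_ball]
          have : Metric.ball x ε ∩ frontier D = ∅ := by
            rw [hD.isOpen.frontier_eq]
            ext z
            simp only [Set.mem_inter_iff, Set.mem_sdiff, Set.mem_empty_iff_false, iff_false]
            exact fun h => h.2.2 (hεD h.1)
          rw [this, measure_empty]
        rw [Measure.restrict_add, h0, add_zero]
        exact Measure.restrict_mono le_rfl Measure.restrict_le_self
      obtain ⟨C, hC, h⟩ := hP
      refine ⟨C, hC, fun φ hφ => ?_⟩
      obtain ⟨c, hc⟩ := h φ hφ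
      exact ⟨c, (lintegral_mono' hm le_rfl).trans hc⟩
    · obtain ⟨A, hAo, hxA, -, hA⟩ := hD.exists_isPoincareSet_of_mem_frontier
        (x₀ := x) (by rw [hD.isOpen.frontier_eq]; exact ⟨hx, hxD⟩)
      exact ⟨A, hAo, hxA, hA⟩

end Domain

/-! ### Multiplication operators on `L²` -/

section Mul

variable {α F : Type*} [MeasurableSpace α] {μ : Measure α} [NormedAddCommGroup F]
  [InnerProductSpace ℝ F]

/-- Multiplication by a bounded function, as an operator on `L²`. -/
def mulLp {f : α → ℝ} (hf : MemLp f ⊤ μ) : Lp F 2 μ →L[ℝ] Lp F 2 μ :=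
  (ContinuousLinearMap.lsmul ℝ ℝ).holderL μ ⊤ 2 2 (hf.toLp f)

theorem coeFn_mulLp {f : α → ℝ} (hf : MemLp f ⊤ μ) (g : Lp F 2 μ) :
    mulLp hf g =ᵐ[μ] fun x => f x • g x := by
  have h := (ContinuousLinearMap.lsmul ℝ ℝ : ℝ →L[ℝ] F →L[ℝ] F).coeFn_holder (r := 2) (hf.toLp f) g
  filter_upwards [h, hf.coeFn_toLp] with x hx hx'
  rw [hx'] at hx
  exact hx

theorem inner_mulLp {f : α → ℝ} (hf : MemLp f ⊤ μ) (g h : Lp F 2 μ) :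
    inner ℝ (mulLp hf g) h = ∫ x, f x * inner ℝ (g x) (h x) ∂μ := by
  rw [L2.inner_def]
  refine integral_congr_ae ?_
  filter_upwards [coeFn_mulLp hf g] with x hx
  rw [hx, real_inner_smul_left]

theorem integrable_mul_inner {f : α → ℝ} (hf : MemLp f ⊤ μ) (g h : Lp F 2 μ) :
    Integrable (fun x => f x * inner ℝ (g x) (h x)) μ := by
  refine (L2.integrable_inner (𝕜 := ℝ) (mulLp hf g) h).congr ?_
  filter_upwards [coeFn_mulLp hf g] with x hx
  rw [hx, real_inner_smul_left]

omit [InnerProductSpace ℝ F] in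
theorem enorm_sq_eq_lintegral (f : Lp F 2 μ) : ‖f‖ₑ ^ 2 = ∫⁻ x, ‖f x‖ₑ ^ 2 ∂μ := by
  rw [Lp.enorm_def]
  have := eLpNorm_nnreal_pow_eq_lintegral (f := f) (μ := μ) (p := 2) two_ne_zero
  simpa using this

/-- A function bounded below by `a` gives a multiplication operator bounded below by `a`. -/
theorem mul_norm_sq_le_inner_mulLp {f : α → ℝ} (hf : MemLp f ⊤ μ) {a : ℝ}
    (ha : ∀ᵐ x ∂μ, a ≤ f x) (g : Lp F 2 μ) : a * ‖g‖ ^ 2 ≤ inner ℝ (mulLp hf g) g := by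
  rw [inner_mulLp, ← real_inner_self_eq_norm_sq, L2.inner_def, ← integral_const_mul]
  refine integral_mono_ae ((L2.integrable_inner (𝕜 := ℝ) g g).const_mul a)
    (integrable_mul_inner hf g g) ?_
  filter_upwards [ha] with x hx
  exact mul_le_mul_of_nonneg_right hx real_inner_self_nonneg

end Mul

/-! ### The energy space -/

section Energy

variable {d : ℕ} (D : Set (EuclideanSpace ℝ (Fin d))) (K : ℕ)

/-- The Hilbert space `L²(D) × L²(D;ℝᵈ) × L²(∂D) × ℝᴷ` of a function, its gradient, its trace and
the electrode voltages. -/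
abbrev PreEnergySpace : Type :=
  WithLp 2 (Lp ℝ 2 (volume.restrict D) × WithLp 2 (Lp (EuclideanSpace ℝ (Fin d)) 2
    (volume.restrict D) × WithLp 2 (Lp ℝ 2 (surface D) × EuclideanSpace ℝ (Fin K))))

namespace PreEnergySpace

/-- The function. -/
def valL : PreEnergySpace D K →L[ℝ] Lp ℝ 2 (volume.restrict D) := WithLp.fstL 2 ℝ _ _

/-- The gradient. -/
def gradL : PreEnergySpace D K →L[ℝ] Lp (EuclideanSpace ℝ (Fin d)) 2 (volume.restrict D) :=
  WithLp.fstL 2 ℝ _ _ ∘L WithLp.sndL 2 ℝ _ _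

/-- The trace. -/
def traceL : PreEnergySpace D K →L[ℝ] Lp ℝ 2 (surface D) :=
  WithLp.fstL 2 ℝ _ _ ∘L WithLp.sndL 2 ℝ _ _ ∘L WithLp.sndL 2 ℝ _ _

/-- The voltages. -/
def voltL : PreEnergySpace D K →L[ℝ] EuclideanSpace ℝ (Fin K) :=
  WithLp.sndL 2 ℝ _ _ ∘L WithLp.sndL 2 ℝ _ _ ∘L WithLp.sndL 2 ℝ _ _

/-- Assembling an element of the space from its components. -/
def assemble : (Lp ℝ 2 (volume.restrict D) × Lp (EuclideanSpace ℝ (Fin d)) 2 (volume.restrict D) ×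
    Lp ℝ 2 (surface D) × EuclideanSpace ℝ (Fin K)) → PreEnergySpace D K :=
  fun p => WithLp.toLp 2 (p.1, WithLp.toLp 2 (p.2.1, WithLp.toLp 2 (p.2.2.1, p.2.2.2)))

theorem continuous_assemble : Continuous (assemble D K) := by
  have h2 : Continuous fun p : Lp ℝ 2 (surface D) × EuclideanSpace ℝ (Fin K) =>
      (WithLp.toLp 2 p : WithLp 2 _) := WithLp.prod_continuous_toLp 2 _ _
  have h1 : Continuous fun p : Lp (EuclideanSpace ℝ (Fin d)) 2 (volume.restrict D) ×
      WithLp 2 (Lp ℝ 2 (surface D) × EuclideanSpace ℝ (Fin K)) =>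
      (WithLp.toLp 2 p : WithLp 2 _) := WithLp.prod_continuous_toLp 2 _ _
  have h0 : Continuous fun p : Lp ℝ 2 (volume.restrict D) × WithLp 2
      (Lp (EuclideanSpace ℝ (Fin d)) 2 (volume.restrict D) ×
      WithLp 2 (Lp ℝ 2 (surface D) × EuclideanSpace ℝ (Fin K))) =>
      (WithLp.toLp 2 p : WithLp 2 _) := WithLp.prod_continuous_toLp 2 _ _
  exact h0.comp (continuous_fst.prodMk (h1.comp ((continuous_fst.comp continuous_snd).prodMk
    (h2.comp (continuous_snd.comp continuous_snd)))))

variable {D K}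

theorem norm_sq_eq (u : PreEnergySpace D K) :
    ‖u‖ ^ 2 = ‖valL D K u‖ ^ 2 + ‖gradL D K u‖ ^ 2 + ‖traceL D K u‖ ^ 2 + ‖voltL D K u‖ ^ 2 := by
  rw [WithLp.prod_norm_sq_eq_of_L2, WithLp.prod_norm_sq_eq_of_L2, WithLp.prod_norm_sq_eq_of_L2,
    ← add_assoc, ← add_assoc]
  rfl

theorem assemble_eq (u : PreEnergySpace D K) :
    assemble D K (valL D K u, gradL D K u, traceL D K u, voltL D K u) = u := rfl

end PreEnergySpace

open PreEnergySpace

/-- The elements given by functions which are smooth up to the boundary. -/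
def smoothSpace : Submodule ℝ (PreEnergySpace D K) where
  carrier := {u | ∃ φ : EuclideanSpace ℝ (Fin d) → ℝ, ContDiff ℝ (⊤ : ℕ∞) φ ∧
    valL D K u =ᵐ[volume.restrict D] φ ∧ gradL D K u =ᵐ[volume.restrict D] gradient φ ∧
    traceL D K u =ᵐ[surface D] φ}
  zero_mem' := by
    refine ⟨fun _ => 0, contDiff_const, ?_, ?_, ?_⟩
    · rw [map_zero]; exact Lp.coeFn_zero _ _ _
    · rw [map_zero]
      filter_upwards [Lp.coeFn_zero (EuclideanSpace ℝ (Fin d)) 2 (volume.restrict D)] with x hx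
      rw [hx, gradient_fun_const]; rfl
    · rw [map_zero]; exact Lp.coeFn_zero _ _ _
  add_mem' := by
    rintro u w ⟨φ, hφ, h1, h2, h3⟩ ⟨η, hη, k1, k2, k3⟩
    refine ⟨φ + η, hφ.add hη, ?_, ?_, ?_⟩
    · rw [map_add]; exact (Lp.coeFn_add _ _).trans (h1.add k1)
    · rw [map_add]
      filter_upwards [Lp.coeFn_add (gradL D K u) (gradL D K w), h2, k2] with x hx hx1 hx2
      rw [hx, Pi.add_apply, hx1, hx2, gradient, gradient, gradient, ← map_add]
      rw [fderiv_add (hφ.differentiable (by simp) x) (hη.differentiable (by simp) x)]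
    · rw [map_add]; exact (Lp.coeFn_add _ _).trans (h3.add k3)
  smul_mem' := by
    rintro c u ⟨φ, hφ, h1, h2, h3⟩
    refine ⟨c • φ, hφ.const_smul c, ?_, ?_, ?_⟩
    · rw [map_smul]; exact (Lp.coeFn_smul _ _).trans (h1.const_smul c)
    · rw [map_smul]
      filter_upwards [Lp.coeFn_smul c (gradL D K u), h2] with x hx hx1
      rw [hx, Pi.smul_apply, hx1, gradient, gradient,
        fderiv_const_smul (hφ.differentiable (by simp) x), LinearIsometryEquiv.map_smulₛₗ]
      rfl
    · rw [map_smul]; exact (Lp.coeFn_smul _ _).trans (h3.const_smul c)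

/-- The energy space `H¹(D) × ℝᴷ`, realized as the closure of the smooth elements. -/
def energySpace : Submodule ℝ (PreEnergySpace D K) := (smoothSpace D K).topologicalClosure

instance : CompleteSpace (energySpace D K) :=
  (smoothSpace D K).isClosed_topologicalClosure.completeSpace_coe

variable {D K}

/-- The element of the energy space given by an `H¹` function and a voltage vector. -/
def H1Fun.toEnergy (v : H1Fun D) (V : EuclideanSpace ℝ (Fin K)) : PreEnergySpace D K :=
  assemble D K (v.memLp_val.toLp, v.memLp_grad.toLp, v.memLp_trace.toLp, V)

theorem continuous_gradient {φ : EuclideanSpace ℝ (Fin d) → ℝ} (hφ : ContDiff ℝ (⊤ : ℕ∞) φ) :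
    Continuous (gradient φ) :=
  (LinearIsometryEquiv.continuous _).comp (hφ.continuous_fderiv (by simp))

theorem memLp_of_continuous_of_bounded {F : Type*} [NormedAddCommGroup F]
    {f : EuclideanSpace ℝ (Fin d) → F} [SecondCountableTopology F] (hf : Continuous f)
    {s : Set (EuclideanSpace ℝ (Fin d))} (hs : Bornology.IsBounded s)
    {μ : Measure (EuclideanSpace ℝ (Fin d))} [IsFiniteMeasure μ] (hμ : ∀ᵐ x ∂μ, x ∈ s)
    (p : ℝ≥0∞) : MemLp f p μ := by
  obtain ⟨C, hC⟩ := hs.isCompact_closure.exists_bound_of_continuousOn hf.continuousOn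
  exact MemLp.of_bound hf.aestronglyMeasurable C (hμ.mono fun x hx => hC x (subset_closure hx))

theorem ae_surface_mem_closure : ∀ᵐ x ∂(surface D), x ∈ closure D :=
  (ae_restrict_mem isClosed_frontier.measurableSet).mono fun _ hx => frontier_subset_closure hx

theorem IsLipschitzDomain.isFiniteMeasure_volume (hD : IsLipschitzDomain D) :
    IsFiniteMeasure (volume.restrict D) := isFiniteMeasure_restrict.2 hD.volume_lt_top.ne

/-- A smooth function satisfies all integrability requirements on a Lipschitz domain. -/
theorem IsLipschitzDomain.memLp_smooth (hD : IsLipschitzDomain D)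
    {φ : EuclideanSpace ℝ (Fin d) → ℝ} (hφ : ContDiff ℝ (⊤ : ℕ∞) φ) :
    MemLp φ 2 (volume.restrict D) ∧ MemLp (gradient φ) 2 (volume.restrict D) ∧
      MemLp φ 2 (surface D) := by
  have := hD.isFiniteMeasure_surface
  have := hD.isFiniteMeasure_volume
  have hmem : ∀ᵐ x ∂(volume.restrict D), x ∈ D := ae_restrict_mem hD.isOpen.measurableSet
  exact ⟨memLp_of_continuous_of_bounded hφ.continuous hD.isBounded hmem 2,
    memLp_of_continuous_of_bounded (continuous_gradient hφ) hD.isBounded hmem 2,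
    memLp_of_continuous_of_bounded hφ.continuous hD.isBounded.closure ae_surface_mem_closure 2⟩

theorem assemble_mem_smoothSpace {φ : EuclideanSpace ℝ (Fin d) → ℝ} (hφ : ContDiff ℝ (⊤ : ℕ∞) φ)
    (h1 : MemLp φ 2 (volume.restrict D)) (h2 : MemLp (gradient φ) 2 (volume.restrict D))
    (h3 : MemLp φ 2 (surface D)) (V : EuclideanSpace ℝ (Fin K)) :
    assemble D K (h1.toLp, h2.toLp, h3.toLp, V) ∈ smoothSpace D K :=
  ⟨φ, hφ, h1.coeFn_toLp, h2.coeFn_toLp, h3.coeFn_toLp⟩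

theorem H1Fun.toEnergy_mem (hD : IsLipschitzDomain D) (v : H1Fun D)
    (V : EuclideanSpace ℝ (Fin K)) : v.toEnergy V ∈ energySpace D K := by
  obtain ⟨φ, hφ, h1, h2, h3⟩ := v.hasTrace
  refine mem_closure_of_tendsto (b := atTop) (f := fun n => assemble D K
    ((hD.memLp_smooth (hφ n)).1.toLp, (hD.memLp_smooth (hφ n)).2.1.toLp,
      (hD.memLp_smooth (hφ n)).2.2.toLp, V)) ?_
    (Eventually.of_forall fun n => assemble_mem_smoothSpace (hφ n) _ _ _ V)
  refine ((continuous_assemble D K).tendsto _).comp ?_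
  exact ((Lp.tendsto_Lp_iff_tendsto_eLpNorm'' _ _ _ v.memLp_val).2 h1).prodMk_nhds
    (((Lp.tendsto_Lp_iff_tendsto_eLpNorm'' _ _ _ v.memLp_grad).2 h2).prodMk_nhds
    (((Lp.tendsto_Lp_iff_tendsto_eLpNorm'' _ _ _ v.memLp_trace).2 h3).prodMk_nhds
      tendsto_const_nhds))

theorem integral_mul_gradient {φ η : EuclideanSpace ℝ (Fin d) → ℝ}
    (hφ : ContDiff ℝ (⊤ : ℕ∞) φ) (hη : ContDiff ℝ (⊤ : ℕ∞) η) (hηc : HasCompactSupport η)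
    (hηD : tsupport η ⊆ D) (i : Fin d) :
    ∫ x in D, φ x * gradient η x i = - ∫ x in D, gradient φ x i * η x := by
  have hg : ∀ f : EuclideanSpace ℝ (Fin d) → ℝ, ∀ x,
      gradient f x i = fderiv ℝ f x (EuclideanSpace.single i 1) := by
    intro f x
    have h := InnerProductSpace.toDual_symm_apply (𝕜 := ℝ) (x := EuclideanSpace.single i (1 : ℝ))
      (y := fderiv ℝ f x)
    rw [← h, EuclideanSpace.inner_single_right]
    simp [gradient]
  simp_rw [hg]
  have hφ' : Continuous fun x => fderiv ℝ φ x (EuclideanSpace.single i 1) :=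
    (hφ.continuous_fderiv (by simp)).clm_apply continuous_const
  have hη' : Continuous fun x => fderiv ℝ η x (EuclideanSpace.single i 1) :=
    (hη.continuous_fderiv (by simp)).clm_apply continuous_const
  have hηc' : HasCompactSupport fun x => fderiv ℝ η x (EuclideanSpace.single i 1) :=
    hηc.fderiv_apply (𝕜 := ℝ) _
  rw [setIntegral_eq_integral_of_forall_compl_eq_zero,
    setIntegral_eq_integral_of_forall_compl_eq_zero]
  · refine integral_mul_fderiv_eq_neg_fderiv_mul_of_integrable ?_ ?_ ?_ ?_ ?_
    · exact (hφ'.mul hη.continuous).integrable_of_hasCompactSupport hηc.mul_left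
    · exact (hφ.continuous.mul hη').integrable_of_hasCompactSupport hηc'.mul_left
    · exact (hφ.continuous.mul hη.continuous).integrable_of_hasCompactSupport hηc.mul_left
    · exact fun x _ => hφ.differentiable (by simp) x
    · exact fun x _ => hη.differentiable (by simp) x
  · intro x hx
    rw [image_eq_zero_of_notMem_tsupport (fun h => hx (hηD h)), mul_zero]
  · intro x hx
    have : x ∉ tsupport (fderiv ℝ η) := fun h => hx (hηD (tsupport_fderiv_subset ℝ h))
    rw [image_eq_zero_of_notMem_tsupport this]
    simp

/-- The gradient component of an element of the energy space is the weak gradient. -/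
theorem hasWeakGradient_of_mem (hD : IsLipschitzDomain D) {u : PreEnergySpace D K}
    (hu : u ∈ energySpace D K) : HasWeakGradient D (valL D K u) (gradL D K u) := by
  intro η hη hηc hηD i
  obtain ⟨m1, m2, -⟩ := hD.memLp_smooth hη
  have ma : MemLp (fun x => gradient η x i) 2 (volume.restrict D) :=
    (EuclideanSpace.proj (𝕜 := ℝ) i).comp_memLp' m2
  have mb : MemLp (fun x => EuclideanSpace.single i (η x)) 2 (volume.restrict D) := by
    have h := (ContinuousLinearMap.toSpanSingleton ℝ
      (EuclideanSpace.single i (1 : ℝ) : EuclideanSpace ℝ (Fin d))).comp_memLp' m1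
    have e : (fun x => EuclideanSpace.single i (η x)) = ContinuousLinearMap.toSpanSingleton ℝ
        (EuclideanSpace.single i (1 : ℝ) : EuclideanSpace ℝ (Fin d)) ∘ η := by
      ext x j
      simp
    rwa [e]
  have hA : ∀ w : PreEnergySpace D K,
      inner ℝ ma.toLp (valL D K w) = ∫ x in D, valL D K w x * gradient η x i := by
    intro w
    rw [L2.inner_def]
    refine integral_congr_ae ?_
    filter_upwards [ma.coeFn_toLp] with x hx
    rw [hx]; simp
  have hB : ∀ w : PreEnergySpace D K,
      inner ℝ mb.toLp (gradL D K w) = ∫ x in D, gradL D K w x i * η x := by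
    intro w
    rw [L2.inner_def]
    refine integral_congr_ae ?_
    filter_upwards [mb.coeFn_toLp] with x hx
    rw [hx, EuclideanSpace.inner_single_left]
    simp [mul_comm]
  suffices h : inner ℝ ma.toLp (valL D K u) = - inner ℝ mb.toLp (gradL D K u) by
    rw [hA, hB] at h; exact h
  refine closure_minimal (t := {w : PreEnergySpace D K |
    inner ℝ ma.toLp (valL D K w) = - inner ℝ mb.toLp (gradL D K w)}) ?_ ?_ hu
  · rintro w ⟨φ, hφ, h1, h2, -⟩
    rw [Set.mem_ofPred_eq, hA, hB]
    refine Eq.trans ?_ ((integral_mul_gradient hφ hη hηc hηD i).trans ?_)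
    · refine integral_congr_ae ?_
      filter_upwards [h1] with x hx
      rw [hx]
    · congr 1
      refine integral_congr_ae ?_
      filter_upwards [h2] with x hx
      rw [hx]
  · exact isClosed_eq (by fun_prop) (by fun_prop)

/-- Every element of the energy space comes from an `H¹` function. -/
theorem exists_toEnergy_eq (hD : IsLipschitzDomain D) {u : PreEnergySpace D K}
    (hu : u ∈ energySpace D K) : ∃ v : H1Fun D, v.toEnergy (voltL D K u) = u := by
  obtain ⟨a, ha, hau⟩ := mem_closure_iff_seq_limit.1 hu
  choose φ hφ h1 h2 h3 using ha
  refine ⟨⟨valL D K u, gradL D K u, traceL D K u, Lp.memLp _, Lp.memLp _,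
    hasWeakGradient_of_mem hD hu, Lp.memLp _, φ, hφ, ?_, ?_, ?_⟩, ?_⟩
  · have h := (Lp.tendsto_Lp_iff_tendsto_eLpNorm' _ _).1 (((valL D K).continuous.tendsto u).comp hau)
    refine h.congr fun n => eLpNorm_congr_ae ((h1 n).sub (ae_eq_refl _))
  · have h := (Lp.tendsto_Lp_iff_tendsto_eLpNorm' _ _).1 (((gradL D K).continuous.tendsto u).comp hau)
    refine h.congr fun n => eLpNorm_congr_ae ((h2 n).sub (ae_eq_refl _))
  · have h := (Lp.tendsto_Lp_iff_tendsto_eLpNorm' _ _).1 (((traceL D K).continuous.tendsto u).comp hau)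
    refine h.congr fun n => eLpNorm_congr_ae ((h3 n).sub (ae_eq_refl _))
  · simp only [H1Fun.toEnergy, Lp.toLp_coeFn]
    exact assemble_eq u

end Energy

/-! ### The bilinear form and its coercivity -/

/-- The inner product of a real inner product space as a continuous bilinear map. -/
def realInnerL (F : Type*) [NormedAddCommGroup F] [InnerProductSpace ℝ F] : F →L[ℝ] F →L[ℝ] ℝ :=
  (innerₗ F).mkContinuous₂ 1 fun x y => by simpa using norm_inner_le_norm (𝕜 := ℝ) x y

section Form

open PreEnergySpace

variable {d K : ℕ} {D : Set (EuclideanSpace ℝ (Fin d))}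
  {E : Fin K → Set (EuclideanSpace ℝ (Fin d))}

theorem IsElectrodes.measurableSet (hE : IsElectrodes D E) (k : Fin K) : MeasurableSet (E k) := by
  obtain ⟨O, hO, h⟩ := hE.relatively_open k
  rw [h]
  exact hO.measurableSet.inter isClosed_frontier.measurableSet

theorem IsElectrodes.electrodeFun_of_mem (hE : IsElectrodes D E) (V : EuclideanSpace ℝ (Fin K))
    {k : Fin K} {x : EuclideanSpace ℝ (Fin d)} (hx : x ∈ E k) : electrodeFun E V x = V k := by
  rw [electrodeFun, Finset.sum_eq_single k]
  · simp [hx]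
  · intro l _ hl
    rw [Set.indicator_of_notMem fun h => (hE.disjoint hl).le_bot ⟨h, hx⟩, mul_zero]
  · simp

theorem IsElectrodes.memLp_indicator (hE : IsElectrodes D E) [IsFiniteMeasure (surface D)]
    (k : Fin K) : MemLp ((E k).indicator (1 : EuclideanSpace ℝ (Fin d) → ℝ)) 2 (surface D) :=
  (memLp_const (1 : ℝ)).indicator (hE.measurableSet k)

/-- The operator `V ↦ ∑ V_k 1_{E_k}` into `L²(∂D)`. -/
def electrodeL (hE : IsElectrodes D E) [IsFiniteMeasure (surface D)] :
    EuclideanSpace ℝ (Fin K) →L[ℝ] Lp ℝ 2 (surface D) :=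
  ∑ k, (EuclideanSpace.proj (𝕜 := ℝ) k).smulRight (hE.memLp_indicator k).toLp

theorem coeFn_electrodeL (hE : IsElectrodes D E) [IsFiniteMeasure (surface D)]
    (V : EuclideanSpace ℝ (Fin K)) : electrodeL hE V =ᵐ[surface D] electrodeFun E V := by
  have h1 : electrodeL hE V = ∑ k, V k • (hE.memLp_indicator k).toLp := by
    simp [electrodeL]
  have h2 : ∀ᵐ x ∂(surface D), ∀ k, (V k • (hE.memLp_indicator k).toLp : Lp ℝ 2 (surface D)) x =
      V k * (E k).indicator (1 : EuclideanSpace ℝ (Fin d) → ℝ) x := by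
    rw [ae_all_iff]
    intro k
    filter_upwards [Lp.coeFn_smul (V k) (hE.memLp_indicator k).toLp,
      (hE.memLp_indicator k).coeFn_toLp] with x hx hx'
    rw [hx, Pi.smul_apply, hx', smul_eq_mul]
  rw [h1]
  filter_upwards [Lp.coeFn_fun_finsetSum Finset.univ fun k => V k • (hE.memLp_indicator k).toLp,
    h2] with x hx hx'
  rw [hx, electrodeFun]
  exact Finset.sum_congr rfl fun k _ => hx' k

/-- The jump `V - v` between the electrode voltages and the trace. -/
def jumpL (hE : IsElectrodes D E) [IsFiniteMeasure (surface D)] :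
    PreEnergySpace D K →L[ℝ] Lp ℝ 2 (surface D) := electrodeL hE ∘L voltL D K - traceL D K

variable (D K) in
/-- The sum of the voltages. -/
def sumL : PreEnergySpace D K →L[ℝ] ℝ := (∑ k, EuclideanSpace.proj (𝕜 := ℝ) k) ∘L voltL D K

theorem sumL_apply (u : PreEnergySpace D K) : sumL K D u = ∑ k, voltL D K u k := by
  simp [sumL]

variable {ζ σ : EuclideanSpace ℝ (Fin d) → ℝ}

/-- The bilinear form of the electrode model, with the penalty `(∑ V_k) (∑ W_k)` added. The penalty
makes it coercive on the whole energy space, and it vanishes for grounded solutions. -/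
def formL (hE : IsElectrodes D E) [IsFiniteMeasure (surface D)] (hζ : MemLp ζ ⊤ (surface D))
    (hσ : MemLp σ ⊤ (volume.restrict D)) : PreEnergySpace D K →L[ℝ] PreEnergySpace D K →L[ℝ] ℝ :=
  (realInnerL _).bilinearComp (mulLp hσ ∘L gradL D K) (gradL D K) +
    (realInnerL _).bilinearComp (mulLp hζ ∘L jumpL hE) (jumpL hE) +
    (ContinuousLinearMap.mul ℝ ℝ).bilinearComp (sumL K D) (sumL K D)

theorem formL_apply (hE : IsElectrodes D E) [IsFiniteMeasure (surface D)]
    (hζ : MemLp ζ ⊤ (surface D)) (hσ : MemLp σ ⊤ (volume.restrict D)) (u w : PreEnergySpace D K) :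
    formL hE hζ hσ u w = inner ℝ (mulLp hσ (gradL D K u)) (gradL D K w) +
      inner ℝ (mulLp hζ (jumpL hE u)) (jumpL hE w) + sumL K D u * sumL K D w := rfl

theorem formL_toEnergy (hE : IsElectrodes D E) [IsFiniteMeasure (surface D)]
    (hζ : MemLp ζ ⊤ (surface D)) (hσ : MemLp σ ⊤ (volume.restrict D)) (v w : H1Fun D)
    (V W : EuclideanSpace ℝ (Fin K)) :
    formL hE hζ hσ (v.toEnergy V) (w.toEnergy W) =
      form D E ζ σ v V w W + (∑ k, V k) * ∑ k, W k := by
  have hj : ∀ (v : H1Fun D) (V : EuclideanSpace ℝ (Fin K)),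
      jumpL hE (v.toEnergy V) =ᵐ[surface D] fun x => electrodeFun E V x - v.trace x := by
    intro v V
    have e : jumpL hE (v.toEnergy V) = electrodeL hE V - v.memLp_trace.toLp := rfl
    rw [e]
    filter_upwards [Lp.coeFn_sub (electrodeL hE V) v.memLp_trace.toLp, coeFn_electrodeL hE V,
      v.memLp_trace.coeFn_toLp] with x h1 h2 h3
    rw [h1, Pi.sub_apply, h2, h3]
  rw [formL_apply, inner_mulLp, inner_mulLp, sumL_apply, sumL_apply, form]
  congr 1
  congr 1
  · refine integral_congr_ae ?_
    have e : ∀ (v : H1Fun D) (V : EuclideanSpace ℝ (Fin K)),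
        gradL D K (v.toEnergy V) = v.memLp_grad.toLp := fun _ _ => rfl
    rw [e, e]
    filter_upwards [v.memLp_grad.coeFn_toLp, w.memLp_grad.coeFn_toLp] with x h1 h2
    rw [h1, h2]
  · refine integral_congr_ae ?_
    filter_upwards [hj v V, hj w W] with x h1 h2
    rw [h1, h2]
    simp only [RCLike.inner_apply, conj_trivial]
    ring

variable (D) in
/-- The constant function `1` in `L²(D)`. -/
def oneVal [IsFiniteMeasure (volume.restrict D)] : Lp ℝ 2 (volume.restrict D) :=
  (memLp_const (1 : ℝ)).toLp

variable (D) in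
/-- The constant function `1` in `L²(∂D)`. -/
def oneTrace [IsFiniteMeasure (surface D)] : Lp ℝ 2 (surface D) := (memLp_const (1 : ℝ)).toLp

theorem enorm_sq_sub_smul_one {α : Type*} [MeasurableSpace α] {μ : Measure α} [IsFiniteMeasure μ]
    {f : Lp ℝ 2 μ} {φ : α → ℝ} (hf : f =ᵐ[μ] φ) (c : ℝ) :
    ‖f - c • ((memLp_const (1 : ℝ)).toLp : Lp ℝ 2 μ)‖ₑ ^ 2 = ∫⁻ x, ‖φ x - c‖ₑ ^ 2 ∂μ := by
  rw [enorm_sq_eq_lintegral]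
  refine lintegral_congr_ae ?_
  filter_upwards [Lp.coeFn_sub f (c • ((memLp_const (1 : ℝ)).toLp : Lp ℝ 2 μ)), hf,
    Lp.coeFn_smul c ((memLp_const (1 : ℝ)).toLp : Lp ℝ 2 μ),
    (memLp_const (1 : ℝ) : MemLp _ 2 μ).coeFn_toLp] with x h1 h2 h3 h4
  rw [h1, Pi.sub_apply, h2, h3, Pi.smul_apply, h4, smul_eq_mul, mul_one]

theorem norm_sq_le_of_enorm_sq_le {F G : Type*} [NormedAddCommGroup F] [NormedAddCommGroup G]
    {a : F} {b : G} {C : ℝ≥0∞} (hC : C ≠ ⊤) (h : ‖a‖ₑ ^ 2 ≤ C * ‖b‖ₑ ^ 2) :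
    ‖a‖ ^ 2 ≤ C.toReal * ‖b‖ ^ 2 := by
  have h' := ENNReal.toReal_mono (by finiteness) h
  simpa using h'

/-- The Poincaré and trace inequalities in the energy space. -/
theorem exists_norm_sub_smul_one_le (hD : IsLipschitzDomain D)
    [IsFiniteMeasure (surface D)] [IsFiniteMeasure (volume.restrict D)] :
    ∃ A : ℝ, 0 ≤ A ∧ ∀ u ∈ smoothSpace D K, ∃ c : ℝ,
      ‖valL D K u - c • oneVal D‖ ^ 2 ≤ A * ‖gradL D K u‖ ^ 2 ∧
      ‖traceL D K u - c • oneTrace D‖ ^ 2 ≤ A * ‖gradL D K u‖ ^ 2 := by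
  obtain ⟨C, hC, h⟩ := hD.isPoincareSet_closure
  refine ⟨C.toReal, ENNReal.toReal_nonneg, ?_⟩
  rintro u ⟨φ, hφ, h1, h2, h3⟩
  obtain ⟨c, hc⟩ := h φ (hφ.of_le (by simp))
  have hcl : (volume.restrict D + surface D).restrict (closure D) =
      volume.restrict D + surface D := by
    rw [Measure.restrict_eq_self_of_ae_mem]
    rw [ae_add_measure_iff]
    exact ⟨(ae_restrict_mem hD.isOpen.measurableSet).mono fun x hx => subset_closure hx,
      ae_surface_mem_closure⟩
  have hg : ∫⁻ x in D, ‖fderiv ℝ φ x‖ₑ ^ 2 = ‖gradL D K u‖ₑ ^ 2 := by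
    rw [enorm_sq_eq_lintegral]
    refine lintegral_congr_ae ?_
    filter_upwards [h2] with x hx
    rw [hx, gradient, LinearIsometryEquiv.enorm_map]
  rw [hcl, lintegral_add_measure, hg] at hc
  refine ⟨c, norm_sq_le_of_enorm_sq_le hC ?_, norm_sq_le_of_enorm_sq_le hC ?_⟩
  · rw [oneVal, enorm_sq_sub_smul_one h1]
    exact le_self_add.trans hc
  · rw [oneTrace, enorm_sq_sub_smul_one h3]
    exact le_add_self.trans hc

theorem inner_mulLp_add_le {α F : Type*} [MeasurableSpace α] {μ : Measure α}
    [NormedAddCommGroup F] [InnerProductSpace ℝ F] {f : α → ℝ} (hf : MemLp f ⊤ μ)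
    (h0 : ∀ᵐ x ∂μ, 0 ≤ f x) (a b : Lp F 2 μ) :
    inner ℝ (mulLp hf (a + b)) (a + b) ≤
      2 * inner ℝ (mulLp hf a) a + 2 * inner ℝ (mulLp hf b) b := by
  have h := mul_norm_sq_le_inner_mulLp hf h0 (a - b)
  simp only [map_add, map_sub, inner_add_left, inner_add_right, inner_sub_left, inner_sub_right]
    at h ⊢
  linarith

/-- The contact admittance sees the voltage of each electrode. -/
theorem exists_sq_le_inner_mulLp (hE : IsElectrodes D E) [IsFiniteMeasure (surface D)]
    (hζ : IsContactAdmittance D E ζ) :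
    ∃ Z : ℝ, 0 ≤ Z ∧ ∀ (V : EuclideanSpace ℝ (Fin K)) (c : ℝ) (k : Fin K),
      (V k - c) ^ 2 ≤ Z * inner ℝ (mulLp hζ.memLp_top (electrodeL hE V - c • oneTrace D))
        (electrodeL hE V - c • oneTrace D) := by
  have hint : Integrable ζ (surface D) := hζ.memLp_top.integrable le_top
  have hz : ∀ k, 0 < ∫ x in E k, ζ x ∂(surface D) := by
    intro k
    have h0 : 0 ≤ᵐ[(surface D).restrict (E k)] ζ := ae_restrict_of_ae hζ.nonneg
    refine lt_of_le_of_ne (integral_nonneg_of_ae h0) fun h => hζ.not_zero k ?_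
    have h1 := (setIntegral_eq_zero_iff_of_nonneg_ae h0 hint.integrableOn).1 h.symm
    exact (ae_restrict_iff' (hE.measurableSet k)).1 h1
  have hkey : ∀ (V : EuclideanSpace ℝ (Fin K)) (c : ℝ) (k : Fin K),
      (V k - c) ^ 2 * ∫ x in E k, ζ x ∂(surface D) ≤
      inner ℝ (mulLp hζ.memLp_top (electrodeL hE V - c • oneTrace D))
        (electrodeL hE V - c • oneTrace D) := by
    intro V c k
    set w := electrodeL hE V - c • oneTrace D with hw
    have hwx : w =ᵐ[surface D] fun x => electrodeFun E V x - c := by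
      filter_upwards [Lp.coeFn_sub (electrodeL hE V) (c • oneTrace D), coeFn_electrodeL hE V,
        Lp.coeFn_smul c (oneTrace D), (memLp_const (1 : ℝ) : MemLp _ 2 (surface D)).coeFn_toLp]
        with x h1 h2 h3 h4
      rw [hw, h1, Pi.sub_apply, h2, h3, Pi.smul_apply, oneTrace, h4, smul_eq_mul, mul_one]
    rw [inner_mulLp, ← integral_const_mul]
    have hi := integrable_mul_inner hζ.memLp_top w w
    refine le_trans (le_of_eq ?_) (setIntegral_le_integral (s := E k) hi ?_)
    · refine setIntegral_congr_ae (hE.measurableSet k) ?_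
      filter_upwards [hwx] with x hx hxE
      rw [hx, hE.electrodeFun_of_mem V hxE]
      simp only [RCLike.inner_apply, conj_trivial]
      ring
    · filter_upwards [hζ.nonneg] with x hx
      exact mul_nonneg hx real_inner_self_nonneg
  refine ⟨∑ k, (∫ x in E k, ζ x ∂(surface D))⁻¹,
    Finset.sum_nonneg fun k _ => (inv_pos.2 (hz k)).le, fun V c k => ?_⟩
  have h1 : (V k - c) ^ 2 ≤ (∫ x in E k, ζ x ∂(surface D))⁻¹ *
      inner ℝ (mulLp hζ.memLp_top (electrodeL hE V - c • oneTrace D))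
        (electrodeL hE V - c • oneTrace D) := by
    rw [← div_eq_inv_mul, le_div_iff₀ (hz k)]
    exact hkey V c k
  refine h1.trans (mul_le_mul_of_nonneg_right ?_ ?_)
  · exact Finset.single_le_sum (f := fun k => (∫ x in E k, ζ x ∂(surface D))⁻¹)
      (fun k _ => (inv_pos.2 (hz k)).le) (Finset.mem_univ k)
  · simpa using mul_norm_sq_le_inner_mulLp hζ.memLp_top hζ.nonneg
      (electrodeL hE V - c • oneTrace D)

theorem norm_sq_le_two_mul {F : Type*} [SeminormedAddCommGroup F] (a b : F) :
    ‖a‖ ^ 2 ≤ 2 * ‖a - b‖ ^ 2 + 2 * ‖b‖ ^ 2 := by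
  have h : ‖a‖ ≤ ‖a - b‖ + ‖b‖ := by simpa using norm_add_le (a - b) b
  nlinarith [norm_nonneg a, sq_nonneg (‖a - b‖ - ‖b‖)]

theorem le_of_mem_energySpace {f g : PreEnergySpace D K → ℝ} (hf : Continuous f)
    (hg : Continuous g) (h : ∀ u ∈ smoothSpace D K, f u ≤ g u) :
    ∀ u ∈ energySpace D K, f u ≤ g u := fun _ hu =>
  closure_minimal (t := {u | f u ≤ g u}) h (isClosed_le hf hg) hu

set_option maxHeartbeats 1000000 in
/-- The energy controls the norm. By the Poincaré inequality, function and trace are close to a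
constant `c`; the admittance then forces all voltages to be close to `c`, and the penalty bounds
their sum, hence `c` itself. -/
theorem exists_norm_sq_le_energy (hD : IsLipschitzDomain D) (hK : 0 < K) (hE : IsElectrodes D E)
    [IsFiniteMeasure (surface D)] (hζ : IsContactAdmittance D E ζ) :
    ∃ M : ℝ, 0 < M ∧ ∀ u ∈ energySpace D K, ‖u‖ ^ 2 ≤ M * (‖gradL D K u‖ ^ 2 +
      inner ℝ (mulLp hζ.memLp_top (jumpL hE u)) (jumpL hE u) + sumL K D u ^ 2) := by
  have := hD.isFiniteMeasure_volume
  obtain ⟨A, hA0, hA⟩ := exists_norm_sub_smul_one_le (K := K) hD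
  obtain ⟨Z, hZ0, hZ⟩ := exists_sq_le_inner_mulLp hE hζ
  set T : Lp ℝ 2 (surface D) →L[ℝ] Lp ℝ 2 (surface D) := mulLp hζ.memLp_top with hT
  set B₁ : ℝ := Z * (2 + 2 * (‖T‖ * A))
  have hB₁ : 0 ≤ B₁ := by positivity
  set B₂ : ℝ := 2 + 2 * ((K : ℝ) ^ 2 * B₁)
  have hB₂ : 0 ≤ B₂ := by positivity
  refine ⟨(2 * A + 2 * (B₂ * ‖oneVal D‖ ^ 2)) + 1 + (2 * A + 2 * (B₂ * ‖oneTrace D‖ ^ 2)) +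
    K * (2 * B₁ + 2 * B₂), by positivity, ?_⟩
  refine le_of_mem_energySpace (by fun_prop) (by fun_prop) fun u hu => ?_
  obtain ⟨c, hc1, hc2⟩ := hA u hu
  set V := voltL D K u
  set q : ℝ := inner ℝ (T (jumpL hE u)) (jumpL hE u) with hq
  have hq0 : 0 ≤ q := by
    simpa using mul_norm_sq_le_inner_mulLp hζ.memLp_top hζ.nonneg (jumpL hE u)
  set g2 : ℝ := ‖gradL D K u‖ ^ 2
  have hg2 : 0 ≤ g2 := by positivity
  set s : ℝ := sumL K D u with hs
  set ε : ℝ := g2 + q + s ^ 2 with hε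
  have hs2 : 0 ≤ s ^ 2 := sq_nonneg s
  have hε0 : 0 ≤ ε := by positivity
  have hVk : ∀ k, (V k - c) ^ 2 ≤ B₁ * ε := by
    intro k
    have e : electrodeL hE V - c • oneTrace D =
        jumpL hE u + (traceL D K u - c • oneTrace D) := by
      have : jumpL hE u = electrodeL hE V - traceL D K u := rfl
      rw [this]; abel
    have h1 := hZ V c k
    rw [e] at h1
    have h2 := inner_mulLp_add_le hζ.memLp_top hζ.nonneg (jumpL hE u)
      (traceL D K u - c • oneTrace D)
    have h3 : inner ℝ (T (traceL D K u - c • oneTrace D)) (traceL D K u - c • oneTrace D) ≤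
        ‖T‖ * (A * g2) := by
      refine (real_inner_le_norm _ _).trans ?_
      calc _ ≤ ‖T‖ * ‖traceL D K u - c • oneTrace D‖ * ‖traceL D K u - c • oneTrace D‖ := by
            gcongr; exact T.le_opNorm _
        _ = ‖T‖ * ‖traceL D K u - c • oneTrace D‖ ^ 2 := by ring
        _ ≤ _ := by gcongr
    calc (V k - c) ^ 2 ≤ Z * (2 * q + 2 * (‖T‖ * (A * g2))) :=
          h1.trans (mul_le_mul_of_nonneg_left (h2.trans (by linarith)) hZ0)
      _ ≤ Z * (2 * ε + 2 * (‖T‖ * (A * ε))) := by gcongr <;> linarith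
      _ = _ := by ring
  have hc : c ^ 2 ≤ B₂ * ε := by
    have hK1 : (1 : ℝ) ≤ K := by exact_mod_cast hK
    -- this is where the penalty enters
    have e : K * c = s - ∑ k, (V k - c) := by
      rw [hs, sumL_apply, Finset.sum_sub_distrib]; simp [V]
    have h1 : (∑ k, (V k - c)) ^ 2 ≤ (K : ℝ) ^ 2 * B₁ * ε := by
      calc (∑ k, (V k - c)) ^ 2 ≤ (K : ℝ) * ∑ k, (V k - c) ^ 2 := by
            simpa using sq_sum_le_card_mul_sum_sq (s := Finset.univ) (f := fun k => V k - c)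
        _ ≤ K * ∑ _k : Fin K, B₁ * ε := by gcongr with k; exact hVk k
        _ = _ := by simp; ring
    have h2 : (K * c) ^ 2 ≤ 2 * s ^ 2 + 2 * (∑ k, (V k - c)) ^ 2 := by
      rw [e]; nlinarith [sq_nonneg (s + ∑ k, (V k - c))]
    have h3 : c ^ 2 ≤ (K * c) ^ 2 := by
      rw [mul_pow]
      exact le_mul_of_one_le_left (sq_nonneg c) (one_le_pow₀ hK1)
    calc c ^ 2 ≤ 2 * s ^ 2 + 2 * ((K : ℝ) ^ 2 * B₁ * ε) := by linarith
      _ ≤ 2 * ε + 2 * ((K : ℝ) ^ 2 * B₁ * ε) := by gcongr; linarith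
      _ = _ := by ring
  have hval : ‖valL D K u‖ ^ 2 ≤ (2 * A + 2 * (B₂ * ‖oneVal D‖ ^ 2)) * ε := by
    calc ‖valL D K u‖ ^ 2 ≤ 2 * ‖valL D K u - c • oneVal D‖ ^ 2 + 2 * ‖c • oneVal D‖ ^ 2 :=
          norm_sq_le_two_mul _ _
      _ = 2 * ‖valL D K u - c • oneVal D‖ ^ 2 + 2 * (c ^ 2 * ‖oneVal D‖ ^ 2) := by
          rw [norm_smul, mul_pow, Real.norm_eq_abs, sq_abs]
      _ ≤ 2 * (A * ε) + 2 * (B₂ * ε * ‖oneVal D‖ ^ 2) := by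
          gcongr
          exact hc1.trans (by gcongr; linarith)
      _ = _ := by ring
  have htr : ‖traceL D K u‖ ^ 2 ≤ (2 * A + 2 * (B₂ * ‖oneTrace D‖ ^ 2)) * ε := by
    calc ‖traceL D K u‖ ^ 2 ≤ 2 * ‖traceL D K u - c • oneTrace D‖ ^ 2 + 2 * ‖c • oneTrace D‖ ^ 2 :=
          norm_sq_le_two_mul _ _
      _ = 2 * ‖traceL D K u - c • oneTrace D‖ ^ 2 + 2 * (c ^ 2 * ‖oneTrace D‖ ^ 2) := by
          rw [norm_smul, mul_pow, Real.norm_eq_abs, sq_abs]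
      _ ≤ 2 * (A * ε) + 2 * (B₂ * ε * ‖oneTrace D‖ ^ 2) := by
          gcongr
          exact hc2.trans (by gcongr; linarith)
      _ = _ := by ring
  have hV : ‖V‖ ^ 2 ≤ K * (2 * B₁ + 2 * B₂) * ε := by
    rw [EuclideanSpace.real_norm_sq_eq]
    calc ∑ k, V k ^ 2 ≤ ∑ _k : Fin K, (2 * B₁ + 2 * B₂) * ε := by
          gcongr with k
          nlinarith [hVk k, sq_nonneg (V k - c - c)]
      _ = _ := by simp; ring
  rw [PreEnergySpace.norm_sq_eq]
  have : g2 ≤ ε := by linarith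
  linarith

/-- Uniform coercivity of the form for conductivities bounded below by `a`. -/
theorem exists_coercive (hD : IsLipschitzDomain D) (hK : 0 < K) (hE : IsElectrodes D E)
    [IsFiniteMeasure (surface D)] (hζ : IsContactAdmittance D E ζ) {a : ℝ} (ha : 0 < a) :
    ∃ α : ℝ, 0 < α ∧ ∀ (σ : EuclideanSpace ℝ (Fin d) → ℝ) (hσ : MemLp σ ⊤ (volume.restrict D)),
      (∀ᵐ x ∂(volume.restrict D), a ≤ σ x) → ∀ u ∈ energySpace D K,
        α * ‖u‖ * ‖u‖ ≤ formL hE hζ.memLp_top hσ u u := by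
  obtain ⟨M, hM, h⟩ := exists_norm_sq_le_energy hD hK hE hζ
  refine ⟨min 1 a / M, by positivity, fun σ hσ hσa u hu => ?_⟩
  have h1 := mul_norm_sq_le_inner_mulLp hσ hσa (gradL D K u)
  have h2 := mul_norm_sq_le_inner_mulLp hζ.memLp_top hζ.nonneg (jumpL hE u)
  rw [zero_mul] at h2
  rw [formL_apply]
  calc min 1 a / M * ‖u‖ * ‖u‖ = min 1 a / M * ‖u‖ ^ 2 := by ring
    _ ≤ min 1 a / M * (M * (‖gradL D K u‖ ^ 2 +
      inner ℝ (mulLp hζ.memLp_top (jumpL hE u)) (jumpL hE u) + sumL K D u ^ 2)) := by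
        gcongr; exact h u hu
    _ = min 1 a * ‖gradL D K u‖ ^ 2 +
      min 1 a * inner ℝ (mulLp hζ.memLp_top (jumpL hE u)) (jumpL hE u) +
        min 1 a * sumL K D u ^ 2 := by field_simp
    _ ≤ a * ‖gradL D K u‖ ^ 2 + 1 * inner ℝ (mulLp hζ.memLp_top (jumpL hE u)) (jumpL hE u) +
        1 * sumL K D u ^ 2 := by
        gcongr
        · exact min_le_right _ _
        · exact min_le_left _ _
        · exact min_le_left _ _
    _ ≤ _ := by rw [one_mul, one_mul, ← sq]; gcongr

end Form

/-! ### Electrode voltages -/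

section LaxMilgram

variable {H : Type*} [NormedAddCommGroup H] [InnerProductSpace ℝ H]

/-- The Lax–Milgram theorem for a form which is coercive on a complete subspace. -/
theorem exists_forall_mem_eq_of_coercive (M : Submodule ℝ H) [CompleteSpace M]
    (B : H →L[ℝ] H →L[ℝ] ℝ) {α : ℝ} (hα : 0 < α) (hB : ∀ u ∈ M, α * ‖u‖ * ‖u‖ ≤ B u u)
    (l : H →L[ℝ] ℝ) : ∃ u ∈ M, ∀ w ∈ M, B u w = l w := by
  have hc : IsCoercive (B.bilinearComp M.subtypeL M.subtypeL) :=
    ⟨α, hα, fun u => hB u u.2⟩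
  set f : M := (InnerProductSpace.toDual ℝ M).symm (l ∘L M.subtypeL)
  refine ⟨hc.continuousLinearEquivOfBilin.symm f, Subtype.coe_prop _, fun w hw => ?_⟩
  have h1 := hc.continuousLinearEquivOfBilin_apply (hc.continuousLinearEquivOfBilin.symm f) ⟨w, hw⟩
  rw [ContinuousLinearEquiv.apply_symm_apply] at h1
  have h2 : inner ℝ f ⟨w, hw⟩ = l w := InnerProductSpace.toDual_symm_apply
  exact h1.symm.trans h2

theorem eq_zero_of_coercive {B : H →L[ℝ] H →L[ℝ] ℝ} {α : ℝ} (hα : 0 < α) {u : H}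
    (hB : α * ‖u‖ * ‖u‖ ≤ B u u) (h0 : B u u = 0) : u = 0 := by
  rw [h0, mul_assoc] at hB
  have h1 : ‖u‖ * ‖u‖ ≤ 0 := by
    by_contra h
    exact absurd hB (not_le.2 (mul_pos hα (not_le.1 h)))
  exact norm_eq_zero.1 (mul_self_eq_zero.1 (le_antisymm h1 (mul_self_nonneg _)))

end LaxMilgram

section Voltage

open PreEnergySpace

variable {d K : ℕ} {D : Set (EuclideanSpace ℝ (Fin d))}
  {E : Fin K → Set (EuclideanSpace ℝ (Fin d))} {ζ σ : EuclideanSpace ℝ (Fin d) → ℝ}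

variable (D) in
/-- The functional `(w, W) ↦ I · W`. -/
def currentL (I : EuclideanSpace ℝ (Fin K)) : PreEnergySpace D K →L[ℝ] ℝ :=
  (∑ k, I k • EuclideanSpace.proj (𝕜 := ℝ) k) ∘L voltL D K

theorem currentL_apply (I : EuclideanSpace ℝ (Fin K)) (u : PreEnergySpace D K) :
    currentL D I u = ∑ k, I k * voltL D K u k := by
  simp [currentL]

/-- The pair of constants `(1, 1)`: it has no gradient, and no jump on the electrodes. -/
theorem exists_const_mem_energySpace (hD : IsLipschitzDomain D) (hE : IsElectrodes D E)
    [IsFiniteMeasure (surface D)] (hζ : IsContactAdmittance D E ζ) :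
    ∃ e ∈ energySpace D K, gradL D K e = 0 ∧ (∀ k, voltL D K e k = 1) ∧
      ∀ t, inner ℝ (mulLp hζ.memLp_top t) (jumpL hE e) = (0 : ℝ) := by
  have hφ : ContDiff ℝ (⊤ : ℕ∞) fun _ : EuclideanSpace ℝ (Fin d) => (1 : ℝ) := contDiff_const
  obtain ⟨h1, h2, h3⟩ := hD.memLp_smooth hφ
  refine ⟨_, Submodule.le_topologicalClosure _
    (assemble_mem_smoothSpace hφ h1 h2 h3 (WithLp.toLp 2 fun _ => 1)), ?_, fun k => rfl, fun t => ?_⟩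
  · have e : gradL D K (assemble D K (h1.toLp, h2.toLp, h3.toLp, WithLp.toLp 2 fun _ => 1)) =
        h2.toLp := rfl
    rw [e, Lp.eq_zero_iff_ae_eq_zero]
    refine h2.coeFn_toLp.trans (Eventually.of_forall fun x => ?_)
    rw [gradient_fun_const]
    rfl
  · rw [inner_mulLp]
    refine integral_eq_zero_of_ae ?_
    have e : jumpL hE (assemble D K (h1.toLp, h2.toLp, h3.toLp, WithLp.toLp 2 fun _ => 1)) =
        electrodeL hE (WithLp.toLp 2 fun _ => 1) - h3.toLp := rfl
    rw [e]
    filter_upwards [Lp.coeFn_sub (electrodeL hE (WithLp.toLp 2 fun _ => 1)) h3.toLp,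
      coeFn_electrodeL hE (WithLp.toLp 2 fun _ => 1), h3.coeFn_toLp, hζ.eq_zero] with x k1 k2 k3 k4
    by_cases hx : x ∈ ⋃ k, E k
    · obtain ⟨k, hk⟩ := Set.mem_iUnion.1 hx
      rw [k1, Pi.sub_apply, k2, k3, hE.electrodeFun_of_mem _ hk]
      simp
    · rw [k4 hx]
      simp

/-- The voltage vectors are the voltage components of the solutions of the penalized problem in the
energy space: testing with constants shows that these solutions are grounded. -/
theorem isVoltage_iff (hD : IsLipschitzDomain D) (hK : 0 < K) (hE : IsElectrodes D E)
    [IsFiniteMeasure (surface D)] (hζ : IsContactAdmittance D E ζ)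
    (hσ : MemLp σ ⊤ (volume.restrict D)) {I : EuclideanSpace ℝ (Fin K)} (hI : ∑ k, I k = 0)
    (V : EuclideanSpace ℝ (Fin K)) :
    IsVoltage D E ζ σ I V ↔ ∃ u ∈ energySpace D K, voltL D K u = V ∧
      ∀ w ∈ energySpace D K, formL hE hζ.memLp_top hσ u w = currentL D I w := by
  constructor
  · rintro ⟨hV, v, hv⟩
    refine ⟨v.toEnergy V, v.toEnergy_mem hD V, rfl, fun w hw => ?_⟩
    obtain ⟨w', hw'⟩ := exists_toEnergy_eq hD hw
    rw [← hw', formL_toEnergy, hv, hV, zero_mul, add_zero, currentL_apply]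
    rfl
  · rintro ⟨u, hu, rfl, h⟩
    obtain ⟨e, he, heg, heV, hej⟩ := exists_const_mem_energySpace hD hE hζ
    have hs : ∑ k, voltL D K u k = 0 := by
      have h1 := h e he
      rw [formL_apply, heg, hej, inner_zero_right, currentL_apply, sumL_apply, sumL_apply] at h1
      simp only [heV, mul_one, hI, Finset.sum_const, Finset.card_univ, Fintype.card_fin,
        nsmul_eq_mul, zero_add] at h1
      have hK' : (K : ℝ) ≠ 0 := by exact_mod_cast hK.ne'
      exact (mul_eq_zero.1 h1).resolve_right hK'
    obtain ⟨v, hv⟩ := exists_toEnergy_eq hD hu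
    refine ⟨hs, v, fun w W => ?_⟩
    have h1 := h (w.toEnergy W) (w.toEnergy_mem hD W)
    rw [← hv, formL_toEnergy, hs, zero_mul, add_zero, currentL_apply] at h1
    exact h1

/-- Without electrodes the zero function solves the problem. -/
theorem isVoltage_of_isEmpty [IsEmpty (Fin K)] (I V : EuclideanSpace ℝ (Fin K)) :
    IsVoltage D E ζ σ I V := by
  refine ⟨by simp, ⟨0, 0, 0, MemLp.zero, MemLp.zero, fun φ _ _ _ i => by simp, MemLp.zero,
    fun _ => 0, fun _ => contDiff_const, ?_, ?_, ?_⟩, fun w W => ?_⟩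
  · simp
  · have : gradient (0 : EuclideanSpace ℝ (Fin d) → ℝ) = 0 := by
      ext1 x; exact gradient_const x 0
    simp [this]
  · simp
  · simp [form, electrodeFun]

theorem existsUnique_isVoltage (hD : IsLipschitzDomain D) (hE : IsElectrodes D E)
    (hζ : IsContactAdmittance D E ζ) (hσ : MemLp σ ⊤ (volume.restrict D)) {a : ℝ} (ha : 0 < a)
    (hσa : ∀ᵐ x ∂(volume.restrict D), a ≤ σ x) {I : EuclideanSpace ℝ (Fin K)}
    (hI : ∑ k, I k = 0) : ∃! V, IsVoltage D E ζ σ I V := by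
  have := hD.isFiniteMeasure_surface
  rcases Nat.eq_zero_or_pos K with rfl | hK
  · exact ⟨0, isVoltage_of_isEmpty I 0, fun V _ => Subsingleton.elim _ _⟩
  obtain ⟨α, hα, hc⟩ := exists_coercive hD hK hE hζ ha
  have hc := hc σ hσ hσa
  obtain ⟨u, hu, huw⟩ := exists_forall_mem_eq_of_coercive (energySpace D K) _ hα hc (currentL D I)
  refine ⟨voltL D K u, (isVoltage_iff hD hK hE hζ hσ hI _).2 ⟨u, hu, rfl, huw⟩, fun V hV => ?_⟩
  obtain ⟨u', hu', rfl, hu'w⟩ := (isVoltage_iff hD hK hE hζ hσ hI _).1 hV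
  have hsub := (energySpace D K).sub_mem hu' hu
  have h0 : u' - u = 0 := by
    refine eq_zero_of_coercive hα (hc _ hsub) ?_
    rw [ContinuousLinearMap.map_sub₂, hu'w _ hsub, huw _ hsub, sub_self]
  rw [sub_eq_zero.1 h0]

theorem formL_sub_formL (hE : IsElectrodes D E) [IsFiniteMeasure (surface D)]
    (hζ : MemLp ζ ⊤ (surface D)) {σ' : EuclideanSpace ℝ (Fin d) → ℝ}
    (hσ : MemLp σ ⊤ (volume.restrict D)) (hσ' : MemLp σ' ⊤ (volume.restrict D))
    (u w : PreEnergySpace D K) :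
    formL hE hζ hσ u w - formL hE hζ hσ' u w =
      inner ℝ (mulLp hσ (gradL D K u) - mulLp hσ' (gradL D K u)) (gradL D K w) := by
  rw [formL_apply, formL_apply, inner_sub_left, add_sub_add_right_eq_sub,
    add_sub_add_right_eq_sub]

theorem norm_gradL_le (w : PreEnergySpace D K) : ‖gradL D K w‖ ≤ ‖w‖ := by
  refine abs_le_of_sq_le_sq' ?_ (norm_nonneg _) |>.2
  rw [PreEnergySpace.norm_sq_eq w]
  linarith [sq_nonneg ‖valL D K w‖, sq_nonneg ‖traceL D K w‖, sq_nonneg ‖voltL D K w‖]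

/-- Two solutions for different conductivities differ by at most the effect of the difference of the
conductivities on one of them. -/
theorem norm_sub_le_of_coercive (hE : IsElectrodes D E)
    [IsFiniteMeasure (surface D)] (hζ : MemLp ζ ⊤ (surface D))
    {σ' : EuclideanSpace ℝ (Fin d) → ℝ}
    (hσ : MemLp σ ⊤ (volume.restrict D)) (hσ' : MemLp σ' ⊤ (volume.restrict D)) {α : ℝ}
    (hα : 0 < α) (hc : ∀ u ∈ energySpace D K, α * ‖u‖ * ‖u‖ ≤ formL hE hζ hσ' u u)
    {l : PreEnergySpace D K →L[ℝ] ℝ} {u u' : PreEnergySpace D K} (hu : u ∈ energySpace D K)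
    (hu' : u' ∈ energySpace D K)
    (h : ∀ w ∈ energySpace D K, formL hE hζ hσ u w = l w)
    (h' : ∀ w ∈ energySpace D K, formL hE hζ hσ' u' w = l w) :
    ‖u' - u‖ ≤ α⁻¹ * ‖mulLp hσ (gradL D K u) - mulLp hσ' (gradL D K u)‖ := by
  have hwM : u' - u ∈ energySpace D K := (energySpace D K).sub_mem hu' hu
  have h1 : formL hE hζ hσ' (u' - u) (u' - u) =
      inner ℝ (mulLp hσ (gradL D K u) - mulLp hσ' (gradL D K u)) (gradL D K (u' - u)) := by
    rw [← formL_sub_formL hE hζ, h _ hwM, ← h' _ hwM, ContinuousLinearMap.map_sub₂]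
  have h2 : α * ‖u' - u‖ * ‖u' - u‖ ≤
      ‖mulLp hσ (gradL D K u) - mulLp hσ' (gradL D K u)‖ * ‖u' - u‖ := by
    refine (hc _ hwM).trans (h1.le.trans ((real_inner_le_norm _ _).trans ?_))
    gcongr
    exact norm_gradL_le _
  rw [← div_eq_inv_mul, le_div_iff₀ hα]
  rcases (norm_nonneg (u' - u)).eq_or_lt with h0 | h0
  · rw [← h0, zero_mul]; exact norm_nonneg _
  · rw [mul_comm]; exact le_of_mul_le_mul_right h2 h0

end Voltage

/-! ### Continuity of the forward map -/

section Forward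

open PreEnergySpace

variable {d K : ℕ} {D : Set (EuclideanSpace ℝ (Fin d))}
  {E : Fin K → Set (EuclideanSpace ℝ (Fin d))} {ζ σbar : EuclideanSpace ℝ (Fin d) → ℝ}
  {ψ : ℕ → EuclideanSpace ℝ (Fin d) → ℝ} {σmin σmax : ℝ}

theorem IsUniformlyElliptic.memLp_conductivity (hσ : IsUniformlyElliptic D σbar ψ σmin σmax)
    (y : ParamSpace) : MemLp (conductivity σbar ψ y) ⊤ (volume.restrict D) := by
  refine memLp_top_of_bound ?_ σmax ?_
  · refine hσ.memLp_σbar.aestronglyMeasurable.add ?_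
    refine aestronglyMeasurable_of_tendsto_ae atTop
      (f := fun n x => ∑ j ∈ Finset.range n, (y j : ℝ) * ψ j x) (fun n => ?_) ?_
    · exact Finset.aestronglyMeasurable_fun_sum _ fun j _ =>
        (hσ.memLp_ψ j).aestronglyMeasurable.const_mul _
    · filter_upwards [hσ.bounds] with x hx
      exact (hx y).1.hasSum.tendsto_sum_nat
  · filter_upwards [hσ.bounds] with x hx
    rw [Real.norm_of_nonneg (hσ.σmin_pos.le.trans (hx y).2.1)]
    exact (hx y).2.2

/-- For almost all `x` the conductivity depends continuously on the parameters, since the series of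
the `ψ_j(x)` converges absolutely. -/
theorem IsUniformlyElliptic.continuous_conductivity (hσ : IsUniformlyElliptic D σbar ψ σmin σmax) :
    ∀ᵐ x ∂(volume.restrict D), Continuous fun y : ParamSpace => conductivity σbar ψ y x := by
  filter_upwards [hσ.bounds] with x hx
  have hs : Summable fun j => |ψ j x| := by
    -- summability at the parameter `y = 1`, which is absolute since the terms are real
    have h := (hx fun _ => ⟨1, by norm_num, le_rfl⟩).1
    simp only [one_mul] at h
    exact h.abs
  refine continuous_const.add (continuous_tsum (fun j => by fun_prop) hs fun j y => ?_)
  rw [norm_mul, Real.norm_eq_abs, Real.norm_eq_abs]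
  exact mul_le_of_le_one_left (abs_nonneg _) (abs_le.2 ⟨(y j).2.1, (y j).2.2⟩)

theorem IsUniformlyElliptic.tendsto_mulLp (hσ : IsUniformlyElliptic D σbar ψ σmin σmax)
    (y₀ : ParamSpace) (g : Lp (EuclideanSpace ℝ (Fin d)) 2 (volume.restrict D)) :
    Tendsto (fun y => ‖mulLp (hσ.memLp_conductivity y₀) g - mulLp (hσ.memLp_conductivity y) g‖)
      (𝓝 y₀) (𝓝 0) := by
  have hn : ∀ y, ‖mulLp (hσ.memLp_conductivity y₀) g - mulLp (hσ.memLp_conductivity y) g‖ ^ 2 =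
      ∫ x in D, (conductivity σbar ψ y₀ x - conductivity σbar ψ y x) ^ 2 * ‖g x‖ ^ 2 := by
    intro y
    rw [← real_inner_self_eq_norm_sq, L2.inner_def]
    refine integral_congr_ae ?_
    filter_upwards [Lp.coeFn_sub (mulLp (hσ.memLp_conductivity y₀) g)
      (mulLp (hσ.memLp_conductivity y) g), coeFn_mulLp (hσ.memLp_conductivity y₀) g,
      coeFn_mulLp (hσ.memLp_conductivity y) g] with x h1 h2 h3
    rw [h1, Pi.sub_apply, h2, h3, ← sub_smul, real_inner_self_eq_norm_sq, norm_smul, mul_pow,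
      Real.norm_eq_abs, sq_abs]
  have hsq : Tendsto (fun y => ‖mulLp (hσ.memLp_conductivity y₀) g -
      mulLp (hσ.memLp_conductivity y) g‖ ^ 2) (𝓝 y₀) (𝓝 0) := by
    simp_rw [hn]
    have hlim : ∫ x in D, (conductivity σbar ψ y₀ x - conductivity σbar ψ y₀ x) ^ 2 *
        ‖g x‖ ^ 2 = 0 := by simp
    rw [← hlim]
    refine tendsto_integral_filter_of_dominated_convergence (fun x => σmax ^ 2 * ‖g x‖ ^ 2)
      (Eventually.of_forall fun y => ?_) (Eventually.of_forall fun y => ?_) ?_ ?_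
    · exact (((hσ.memLp_conductivity y₀).aestronglyMeasurable.sub
        (hσ.memLp_conductivity y).aestronglyMeasurable).pow 2).mul
        ((Lp.aestronglyMeasurable g).norm.pow 2)
    · filter_upwards [hσ.bounds] with x hx
      rw [Real.norm_of_nonneg (by positivity)]
      gcongr ?_ * _
      have := hσ.σmin_pos
      refine sq_le_sq' ?_ ?_ <;> linarith [(hx y).2.1, (hx y).2.2, (hx y₀).2.1, (hx y₀).2.2]
    · exact ((Lp.memLp g).integrable_norm_pow two_ne_zero).const_mul _
    · filter_upwards [hσ.continuous_conductivity] with x hx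
      exact ((tendsto_const_nhds.sub (hx.tendsto y₀)).pow 2).mul_const _
  have := hsq.sqrt
  simpa [Real.sqrt_sq (norm_nonneg _)] using this

theorem isVoltage_voltage (hD : IsLipschitzDomain D) (hE : IsElectrodes D E)
    (hζ : IsContactAdmittance D E ζ) (hσ : IsUniformlyElliptic D σbar ψ σmin σmax)
    {I : EuclideanSpace ℝ (Fin K)} (hI : ∑ k, I k = 0) (y : ParamSpace) :
    IsVoltage D E ζ (conductivity σbar ψ y) I (voltage D E ζ (conductivity σbar ψ y) I) :=
  Classical.epsilon_spec (existsUnique_isVoltage hD hE hζ (hσ.memLp_conductivity y) hσ.σmin_pos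
    (hσ.bounds.mono fun _ hx => (hx y).2.1) hI).exists

theorem continuous_voltage (hD : IsLipschitzDomain D) (hE : IsElectrodes D E)
    (hζ : IsContactAdmittance D E ζ) (hσ : IsUniformlyElliptic D σbar ψ σmin σmax)
    {I : EuclideanSpace ℝ (Fin K)} (hI : ∑ k, I k = 0) :
    Continuous fun y : ParamSpace => voltage D E ζ (conductivity σbar ψ y) I := by
  have := hD.isFiniteMeasure_surface
  rcases Nat.eq_zero_or_pos K with rfl | hK
  · exact continuous_of_const fun _ _ => Subsingleton.elim _ _
  obtain ⟨α, hα, hc⟩ := exists_coercive hD hK hE hζ hσ.σmin_pos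
  have hsol := fun y => (isVoltage_iff hD hK hE hζ (hσ.memLp_conductivity y) hI _).1
    (isVoltage_voltage hD hE hζ hσ hI y)
  choose u hu huV huw using hsol
  simp_rw [← huV]
  refine (voltL D K).continuous.comp (continuous_iff_continuousAt.2 fun y₀ => ?_)
  rw [ContinuousAt, tendsto_iff_norm_sub_tendsto_zero]
  have hlim := (hσ.tendsto_mulLp y₀ (gradL D K (u y₀))).const_mul α⁻¹
  rw [mul_zero] at hlim
  exact squeeze_zero (fun _ => norm_nonneg _) (fun y => norm_sub_le_of_coercive hE hζ.memLp_top
    (hσ.memLp_conductivity y₀) (hσ.memLp_conductivity y) hα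
    (hc _ _ (hσ.bounds.mono fun _ hx => (hx y).2.1)) (hu y₀) (hu y) (huw y₀) (huw y)) hlim

theorem continuous_forwardMap (hD : IsLipschitzDomain D) (hE : IsElectrodes D E)
    (hζ : IsContactAdmittance D E ζ) (hσ : IsUniformlyElliptic D σbar ψ σmin σmax)
    {I : Fin (K - 1) → EuclideanSpace ℝ (Fin K)} (hI : ∀ k, ∑ l, I k l = 0) :
    Continuous (forwardMap D E ζ σbar ψ I) := by
  refine (PiLp.continuous_toLp 2 _).comp (continuous_pi fun p => ?_)
  exact (EuclideanSpace.proj (𝕜 := ℝ) p.2).continuous.comp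
    (continuous_voltage hD hE hζ hσ (hI p.1))

end Forward

/-! ### Densities of Gaussian measures -/

section Gaussian

theorem map_withDensity_comp {α β : Type*} [MeasurableSpace α] [MeasurableSpace β] (μ : Measure α)
    {e : α → β} (he : Measurable e) {f : β → ℝ≥0∞} (hf : Measurable f) :
    (μ.withDensity (f ∘ e)).map e = (μ.map e).withDensity f := by
  ext s hs
  rw [Measure.map_apply he hs, withDensity_apply _ (he hs), withDensity_apply _ hs,
    setLIntegral_map hs hf he]
  rfl

variable {ι : Type*} [Fintype ι]

theorem pi_gaussianReal_eq_withDensity :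
    Measure.pi (fun _ : ι => gaussianReal 0 1) =
      volume.withDensity fun x => ENNReal.ofReal (∏ i, gaussianPDFReal 0 1 (x i)) := by
  have hm : Measurable fun x : ι → ℝ => ENNReal.ofReal (∏ i, gaussianPDFReal 0 1 (x i)) :=
    (Finset.measurable_fun_prod _ fun i _ =>
      (measurable_gaussianPDFReal 0 1).comp (measurable_pi_apply i)).ennreal_ofReal
  refine Measure.pi_eq fun s hs => ?_
  have hint : ∀ i, Integrable (gaussianPDFReal 0 1) (volume.restrict (s i)) := fun i =>
    (integrable_gaussianPDFReal 0 1).integrableOn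
  rw [withDensity_apply _ (MeasurableSet.univ_pi hs), volume_pi, Measure.restrict_pi_pi,
    ← ofReal_integral_eq_lintegral_ofReal (Integrable.fintype_prod hint)
      (Eventually.of_forall fun x => Finset.prod_nonneg fun i _ => gaussianPDFReal_nonneg 0 1 _),
    integral_fintype_prod_eq_prod,
    ENNReal.ofReal_prod_of_nonneg fun i _ => integral_nonneg fun x => gaussianPDFReal_nonneg 0 1 _]
  refine Finset.prod_congr rfl fun i _ => ?_
  rw [gaussianReal_apply_eq_integral 0 one_ne_zero]

/-- The standard Gaussian measure has density proportional to `exp (-|x|²/2)`. -/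
theorem exists_stdGaussian_eq_withDensity :
    ∃ c : ℝ, 0 < c ∧ stdGaussian (EuclideanSpace ℝ ι) =
      volume.withDensity fun x => ENNReal.ofReal (c * Real.exp (-(1 / 2 * ‖x‖ ^ 2))) := by
  refine ⟨∏ _i : ι, (√(2 * Real.pi * (1 : ℝ≥0)))⁻¹, Finset.prod_pos fun i _ => by positivity, ?_⟩
  have h := map_withDensity_comp (volume : Measure (ι → ℝ)) (e := WithLp.toLp 2)
    (PiLp.volume_preserving_toLp ι).measurable
    (f := fun x : EuclideanSpace ℝ ι => ENNReal.ofReal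
      ((∏ _i : ι, (√(2 * Real.pi * (1 : ℝ≥0)))⁻¹) * Real.exp (-(1 / 2 * ‖x‖ ^ 2))))
    (by fun_prop)
  rw [(PiLp.volume_preserving_toLp ι).map_eq] at h
  rw [← h, ← map_pi_eq_stdGaussian, pi_gaussianReal_eq_withDensity]
  congr 2
  ext x
  simp only [gaussianPDFReal_def, Function.comp, Finset.prod_mul_distrib, ← Real.exp_sum]
  rw [EuclideanSpace.real_norm_sq_eq, Finset.mul_sum, ← Finset.sum_neg_distrib]
  congr 4
  ext i
  simp
  ring

open scoped MatrixOrder in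
/-- A nondegenerate Gaussian measure has a density with respect to a translation invariant
measure. -/
theorem exists_multivariateGaussian_eq_withDensity [DecidableEq ι] {S : Matrix ι ι ℝ}
    (hS : S.PosDef) : ∃ (ρ : Measure (EuclideanSpace ℝ ι)) (c : ℝ), ρ.IsAddHaarMeasure ∧ 0 < c ∧
      multivariateGaussian 0 S = ρ.withDensity fun z =>
        ENNReal.ofReal (c * Real.exp
          (-(1 / 2 * ‖Matrix.toEuclideanCLM (𝕜 := ℝ) (CFC.sqrt S)⁻¹ z‖ ^ 2))) := by
  obtain ⟨c, hc, h⟩ := exists_stdGaussian_eq_withDensity (ι := ι)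
  have hu : IsUnit (CFC.sqrt S) := by
    have h1 : CFC.sqrt S * CFC.sqrt S = S := CFC.sqrt_mul_sqrt_self S hS.posSemidef.nonneg
    have h2 := hS.isUnit
    rw [← h1] at h2
    exact (isUnit_mul_self_iff).1 h2
  have hdet : IsUnit (CFC.sqrt S).det := (Matrix.isUnit_iff_isUnit_det _).1 hu
  have hleft : ∀ x, Matrix.toEuclideanCLM (𝕜 := ℝ) (CFC.sqrt S)⁻¹
      (Matrix.toEuclideanCLM (𝕜 := ℝ) (CFC.sqrt S) x) = x := by
    intro x
    rw [← mul_apply_eq_comp, ← map_mul, Matrix.nonsing_inv_mul _ hdet, map_one]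
    rfl
  have hright : ∀ x, Matrix.toEuclideanCLM (𝕜 := ℝ) (CFC.sqrt S)
      (Matrix.toEuclideanCLM (𝕜 := ℝ) (CFC.sqrt S)⁻¹ x) = x := by
    intro x
    rw [← mul_apply_eq_comp, ← map_mul, Matrix.mul_nonsing_inv _ hdet, map_one]
    rfl
  let A : EuclideanSpace ℝ ι ≃L[ℝ] EuclideanSpace ℝ ι :=
    ContinuousLinearEquiv.equivOfInverse (Matrix.toEuclideanCLM (𝕜 := ℝ) (CFC.sqrt S))
      (Matrix.toEuclideanCLM (𝕜 := ℝ) (CFC.sqrt S)⁻¹) hleft hright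
  refine ⟨volume.map A, c, A.isAddHaarMeasure_map _, hc, ?_⟩
  have hA : (fun x => 0 + Matrix.toEuclideanCLM (𝕜 := ℝ) (CFC.sqrt S) x) = A := by
    ext1 x
    rw [zero_add]
    rfl
  have hA' : ∀ x, Matrix.toEuclideanCLM (𝕜 := ℝ) (CFC.sqrt S)⁻¹ (A x) = x := hleft
  rw [← map_withDensity_comp _ A.continuous.measurable (by fun_prop), multivariateGaussian, h, hA]
  simp only [Function.comp_def, hA']

end Gaussian

/-! ### Bayes' formula -/

section Bayes

/-- Bayes' formula for additive noise whose density is proportional to `exp (-h)`. -/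
theorem exists_posterior {U Δ Ω : Type*} [MeasurableSpace U] [StandardBorelSpace U] [Nonempty U]
    [AddCommGroup Δ] [MeasurableSpace Δ] [MeasurableAdd₂ Δ] [MeasurableSub₂ Δ]
    [MeasurableSpace Ω] (P : Measure Ω) [IsProbabilityMeasure P]
    (π : Measure U) [IsProbabilityMeasure π] (ν ρ : Measure Δ) [SFinite ρ] [ρ.IsAddLeftInvariant]
    {h : Δ → ℝ} (hm : Measurable h) (h0 : ∀ z, 0 ≤ h z) {c : ℝ} (hc : 0 < c)
    (hν : ν = ρ.withDensity fun z => ENNReal.ofReal (c * Real.exp (-h z)))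
    {G : U → Δ} (hG : Measurable G) {Y : Ω → U} (hY : HasLaw Y π P) {ϑ : Ω → Δ}
    (hϑ : HasLaw ϑ ν P) (hYϑ : IndepFun Y ϑ P) :
    ∃ κ : Kernel Δ U, IsMarkovKernel κ ∧
      (κ =ᵐ[P.map fun t => G (Y t) + ϑ t] condDistrib Y (fun t => G (Y t) + ϑ t) P) ∧
      ∀ δ, κ δ ≪ π ∧ ∃ a : ℝ, 0 < a ∧ (κ δ).rnDeriv π =ᵐ[π] fun y =>
        ENNReal.ofReal (a * Real.exp (-h (δ - G y))) := by
  have hνp : IsProbabilityMeasure ν := hϑ.map_eq ▸ Measure.isProbabilityMeasure_map hϑ.aemeasurable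
  -- the likelihood and the normalizing constant
  set L : Δ → U → ℝ := fun δ y => Real.exp (-h (δ - G y)) with hL
  have hLm : Measurable (Function.uncurry L) := by
    have : Measurable fun p : Δ × U => p.1 - G p.2 := by fun_prop
    exact (hm.comp this).neg.exp
  have hLm' : ∀ δ, Measurable (L δ) := fun δ => hLm.comp measurable_prodMk_left
  have hLpos : ∀ δ y, 0 < L δ y := fun δ y => Real.exp_pos _
  have hLint : ∀ δ, Integrable (L δ) π := fun δ =>
    Integrable.of_bound (hLm' δ).aestronglyMeasurable 1 (Eventually.of_forall fun y => by
      rw [Real.norm_of_nonneg (hLpos δ y).le]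
      exact Real.exp_le_one_iff.2 (neg_nonpos.2 (h0 _)))
  set Z : Δ → ℝ := fun δ => ∫ y, L δ y ∂π with hZ
  have hZpos : ∀ δ, 0 < Z δ := fun δ => integral_exp_pos (hLint δ)
  have hZm : Measurable Z := (hLm.stronglyMeasurable.integral_prod_right (ν := π)).measurable
  have hZ' : ∀ δ, ∫⁻ y, ENNReal.ofReal (L δ y) ∂π = ENNReal.ofReal (Z δ) := fun δ =>
    (ofReal_integral_eq_lintegral_ofReal (hLint δ)
      (Eventually.of_forall fun y => (hLpos δ y).le)).symm
  set f : Δ → U → ℝ≥0∞ := fun δ y => ENNReal.ofReal ((Z δ)⁻¹ * L δ y) with hf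
  have hfm : Measurable (Function.uncurry f) :=
    ((hZm.comp measurable_fst).inv.mul hLm).ennreal_ofReal
  have hfm' : ∀ δ, Measurable (f δ) := fun δ => hfm.comp measurable_prodMk_left
  set κ : Kernel Δ U := Kernel.withDensity (Kernel.const Δ π) f with hκ
  have hκδ : ∀ δ, κ δ = π.withDensity (f δ) := fun δ => by
    rw [hκ, Kernel.withDensity_apply _ hfm, Kernel.const_apply]
  have hκM : IsMarkovKernel κ := by
    refine ⟨fun δ => ⟨?_⟩⟩
    rw [hκδ, withDensity_apply _ MeasurableSet.univ, Measure.restrict_univ]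
    simp only [hf, ENNReal.ofReal_mul (inv_nonneg.2 (hZpos δ).le)]
    rw [lintegral_const_mul' _ _ ENNReal.ofReal_ne_top, hZ', ← ENNReal.ofReal_mul
      (inv_nonneg.2 (hZpos δ).le), inv_mul_cancel₀ (hZpos δ).ne', ENNReal.ofReal_one]
  refine ⟨κ, hκM, ?_, fun δ => ⟨?_, (Z δ)⁻¹, inv_pos.2 (hZpos δ), ?_⟩⟩
  · -- the joint law of the data and the parameter
    have hmap : P.map (fun t => (G (Y t) + ϑ t, Y t)) =
        (π.prod ν).map fun p => (G p.1 + p.2, p.1) := by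
      have h1 : P.map (fun t => (Y t, ϑ t)) = π.prod ν := by
        rw [(indepFun_iff_map_prod_eq_prod_map_map hY.aemeasurable hϑ.aemeasurable).1 hYϑ,
          hY.map_eq, hϑ.map_eq]
      rw [← h1, AEMeasurable.map_map_of_aemeasurable (by fun_prop)
        (hY.aemeasurable.prodMk hϑ.aemeasurable)]
      rfl
    have hjoint : ∀ F : Δ × U → ℝ≥0∞, Measurable F →
        ∫⁻ p, F p ∂(P.map fun t => (G (Y t) + ϑ t, Y t)) =
          ∫⁻ δ, ∫⁻ y, F (δ, y) * ENNReal.ofReal (c * L δ y) ∂π ∂ρ := by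
      intro F hF
      have hd : Measurable fun z => ENNReal.ofReal (c * Real.exp (-h z)) := by fun_prop
      have hFL : Measurable fun p : U × Δ => F (p.2, p.1) * ENNReal.ofReal (c * L p.2 p.1) :=
        (hF.comp measurable_swap).mul ((hLm.comp measurable_swap).const_mul c).ennreal_ofReal
      have hFG : Measurable fun p : U × Δ => F (G p.1 + p.2, p.1) := hF.comp (by fun_prop)
      rw [hmap, lintegral_map hF (by fun_prop), lintegral_prod _ hFG.aemeasurable,
        lintegral_lintegral_swap (f := fun δ y => F (δ, y) * ENNReal.ofReal (c * L δ y))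
          (hFL.comp measurable_swap).aemeasurable]
      refine lintegral_congr fun y => ?_
      have hFy : Measurable fun z => F (G y + z, y) := hFG.comp measurable_prodMk_left
      rw [hν, lintegral_withDensity_eq_lintegral_mul _ hd hFy]
      refine Eq.trans ?_ (lintegral_add_left_eq_self (μ := ρ)
        (fun x => F (x, y) * ENNReal.ofReal (c * L x y)) (G y))
      refine lintegral_congr fun z => ?_
      simp only [Pi.mul_apply, hL, add_sub_cancel_left]
      rw [mul_comm]
    have hX : AEMeasurable (fun t => G (Y t) + ϑ t) P :=
      (hG.comp_aemeasurable hY.aemeasurable).add hϑ.aemeasurable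
    have hmarg : P.map (fun t => G (Y t) + ϑ t) =
        ρ.withDensity fun δ => ENNReal.ofReal (c * Z δ) := by
      refine Measure.ext_of_lintegral _ fun F hF => ?_
      have h1 := hjoint (fun p => F p.1) (hF.comp measurable_fst)
      rw [lintegral_map' (by fun_prop) (hX.prodMk hY.aemeasurable)] at h1
      rw [lintegral_map' hF.aemeasurable hX, h1,
        lintegral_withDensity_eq_lintegral_mul _ (by fun_prop) hF]
      refine lintegral_congr fun δ => ?_
      have hLc : Measurable fun y => ENNReal.ofReal (c * L δ y) :=
        ((hLm' δ).const_mul c).ennreal_ofReal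
      simp only [Pi.mul_apply]
      rw [lintegral_const_mul _ hLc, mul_comm]
      congr 1
      simp only [ENNReal.ofReal_mul hc.le]
      rw [lintegral_const_mul' _ _ ENNReal.ofReal_ne_top, hZ']
    refine (condDistrib_ae_eq_of_measure_eq_compProd _ hY.aemeasurable ?_).symm
    refine Measure.ext_of_lintegral _ fun F hF => ?_
    rw [hjoint F hF, Measure.lintegral_compProd hF, hmarg,
      lintegral_withDensity_eq_lintegral_mul _ (by fun_prop)
        (hF.lintegral_kernel_prod_right')]
    refine lintegral_congr fun δ => ?_
    have hFδ : Measurable fun y => F (δ, y) := hF.comp measurable_prodMk_left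
    rw [Pi.mul_apply, hκδ, lintegral_withDensity_eq_lintegral_mul _ (hfm' δ) hFδ, ← lintegral_const_mul' _ _ ENNReal.ofReal_ne_top]
    refine lintegral_congr fun y => ?_
    rw [Pi.mul_apply, ← mul_assoc, hf, ← ENNReal.ofReal_mul (mul_pos hc (hZpos δ)).le, mul_comm]
    congr 2
    have := (hZpos δ).ne'
    field_simp
  · rw [hκδ]
    exact withDensity_absolutelyContinuous _ _
  · rw [hκδ]
    exact Measure.rnDeriv_withDensity _ (hfm' δ)

end Bayes

end EIT

end

/-- Bayesian electrical impedance tomography. The unknown `Y` has the uniform product prior on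
`[-1,1]^ℕ`, and `𝒢(Y) + ϑ` is observed with independent noise `ϑ ∼ N(0, S)`. The forward map `𝒢` is
well defined and measurable, and the posterior, that is, the conditional distribution of `Y` given
the observation, has a version `μpost` such that for every value `δ` of the data `μpost δ` is
absolutely continuous with respect to the prior with density proportional to `exp (-Φ(y;δ))`. -/
theorem mainTheorem10 {d K : ℕ} (hd : d = 2 ∨ d = 3)
    (D : Set (EuclideanSpace ℝ (Fin d))) (hD : EIT.IsLipschitzDomain D)
    (E : Fin K → Set (EuclideanSpace ℝ (Fin d))) (hE : EIT.IsElectrodes D E)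
    (ζ : EuclideanSpace ℝ (Fin d) → ℝ) (hζ : EIT.IsContactAdmittance D E ζ)
    (σbar : EuclideanSpace ℝ (Fin d) → ℝ) (ψ : ℕ → EuclideanSpace ℝ (Fin d) → ℝ)
    (σmin σmax : ℝ) (hσ : EIT.IsUniformlyElliptic D σbar ψ σmin σmax)
    (I : Fin (K - 1) → EuclideanSpace ℝ (Fin K)) (hI : ∀ k, ∑ l, I k l = 0)
    (hI_indep : LinearIndependent ℝ I)
    (S : Matrix (Fin (K - 1) × Fin K) (Fin (K - 1) × Fin K) ℝ) (hS : S.PosDef)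
    {Ω : Type*} [MeasurableSpace Ω] (P : Measure Ω) [IsProbabilityMeasure P]
    (Y : Ω → EIT.ParamSpace) (hY : HasLaw Y EIT.prior P)
    (ϑ : Ω → EIT.DataSpace K) (hϑ : HasLaw ϑ (multivariateGaussian 0 S) P)
    (hYϑ : IndepFun Y ϑ P) :
    (∀ (y : EIT.ParamSpace) (J : EuclideanSpace ℝ (Fin K)), ∑ k, J k = 0 →
      ∃! V : EuclideanSpace ℝ (Fin K),
        EIT.IsVoltage D E ζ (EIT.conductivity σbar ψ y) J V) ∧
    Measurable (EIT.forwardMap D E ζ σbar ψ I) ∧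
    ∃ μpost : Kernel (EIT.DataSpace K) EIT.ParamSpace, IsMarkovKernel μpost ∧
      (μpost =ᵐ[P.map fun t => EIT.forwardMap D E ζ σbar ψ I (Y t) + ϑ t]
        condDistrib Y (fun t => EIT.forwardMap D E ζ σbar ψ I (Y t) + ϑ t) P) ∧
      ∀ δ : EIT.DataSpace K, μpost δ ≪ EIT.prior ∧
        ∃ c : ℝ, 0 < c ∧ (μpost δ).rnDeriv EIT.prior =ᵐ[EIT.prior] fun y =>
          ENNReal.ofReal
            (c * Real.exp (-EIT.misfit (EIT.forwardMap D E ζ σbar ψ I) S y δ)) := by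
  have hG : Measurable (EIT.forwardMap D E ζ σbar ψ I) :=
    (EIT.continuous_forwardMap hD hE hζ hσ hI).measurable
  refine ⟨fun y J hJ => EIT.existsUnique_isVoltage hD hE hζ (hσ.memLp_conductivity y) hσ.σmin_pos
    (hσ.bounds.mono fun _ hx => (hx y).2.1) hJ, hG, ?_⟩
  obtain ⟨ρ, c, hρ, hc, hν⟩ := EIT.exists_multivariateGaussian_eq_withDensity hS
  exact EIT.exists_posterior P EIT.prior _ ρ (by fun_prop) (fun z => by positivity) hc hν hG hY hϑ
    hYϑ
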